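/- Let $a<b$ and $A,B$ be real numbers and let $L=L(x,u,v)\in C([a,b]\times\mathbb R\times\mathbb R)$ satisfy: (H$_1$) for each compact $G\subset[a,b]\times\mathbb R\times\mathbb R$ there are $C>0$ and $\alpha>0$ such that $|L(x_1,u_1,v_1)-L(x_2,u_2,v_2)|\le C(|x_1-x_2|+|u_1-u_2|+|v_1-v_2|)^\alpha$ for all $(x_1,u_1,v_1),(x_2,u_2,v_2)\in G$; (H$_2$) the second partial derivative $L_{vv}$ exists and is continuous on $[a,b]\times\mathbb R\times\mathbb R$, and there is $\mu>0$ such that $L_{vv}\ge\mu$ everywhere. Let $f,g\in C^1([a,b])$ with $f<g$ on $[a,b]$. For a continuous $h:[a,b]\to\mathbb R$ let $\omega_h(\varepsilon)=\sup\{|h(x)-h(y)|:x,y\in[a,b],\ |x-y|\le\varepsilon\}$ be its modulus of continuity, and suppose that $$\lim_{\varepsilon\to0^+}\int_0^{\mathrm e\varepsilon}\big[\omega_h(\xi+\gamma\sqrt\xi)\big]^\theta\,\frac{d\xi}{\xi}=0\qquad\text{for all }h\in\{f,f',g,g'\}\text{ and all }\gamma,\theta>0,$$ where $\mathrm e$ is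 Napier's number. Let $\mathcal A_{f,g}$ be the set of all $u\in W^{1,1}([a,b])$ (that is, $u$ absolutely continuous on $[a,b]$) with $u(a)=A$, $u(b)=B$ and $f\le u\le g$ on $[a,b]$. Let $u\in\mathcal A_{f,g}$ be a solution of the obstacle problem, i.e. $\int_a^bL(x,u,u')\,dx\le\int_a^bL(x,v,v')\,dx$ for all $v\in\mathcal A_{f,g}$ (the integrals take values in $(-\infty,\infty]$). Then $u$ has Tonelli's partial regularity: the set $\Omega_u$ of the points of $[a,b]$ at which $u:[a,b]\to\mathbb R$ is differentiable (one-sidedly at $a$ and $b$) is relatively open in $[a,b]$; $[a,b]\setminus\Omega_u=\{x\in[a,b]:u'(x)=-\infty\text{ or }u'(x)=+\infty\}$; and $u'$ is continuous from $[a,b]$ to $[-\infty,\infty]$. -/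

import Mathlib

open Set Filter Topology MeasureTheory

namespace ObstacleProblem

/-- Functions on `[a,b]` are represented by functions on `ℝ`, of which only the values on `[a,b]`
matter.  `W^{1,1}([a,b])` is the class of absolutely continuous functions on `[a,b]`. -/
def MemW11 (a b : ℝ) (u : ℝ → ℝ) : Prop :=
  AbsolutelyContinuousOnInterval u a b

/-- The domain `[a,b] × ℝ × ℝ` of the Lagrangian. -/
def lagDomain (a b : ℝ) : Set (ℝ × ℝ × ℝ) :=
  Icc a b ×ˢ (univ : Set (ℝ × ℝ))

/-- `L ∈ C([a,b] × ℝ × ℝ)`. -/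
def LagContinuous (a b : ℝ) (L : ℝ → ℝ → ℝ → ℝ) : Prop :=
  ContinuousOn (fun p : ℝ × ℝ × ℝ => L p.1 p.2.1 p.2.2) (lagDomain a b)

/-- `L` is locally Hölder continuous, the constant and the exponent
depending on the compact set. -/
def LocallyHolder (a b : ℝ) (L : ℝ → ℝ → ℝ → ℝ) : Prop :=
  ∀ G : Set (ℝ × ℝ × ℝ), IsCompact G → G ⊆ lagDomain a b →
    ∃ C > (0 : ℝ), ∃ α > (0 : ℝ), ∀ p ∈ G, ∀ q ∈ G,
      |L p.1 p.2.1 p.2.2 - L q.1 q.2.1 q.2.2| ≤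
        C * (|p.1 - q.1| + |p.2.1 - q.2.1| + |p.2.2 - q.2.2|) ^ α

/-- Global ellipticity: the second partial derivative `L_vv` exists and is continuous on
`[a,b] × ℝ × ℝ`, and `L_vv ≥ μ` there for some constant `μ > 0`. -/
def GloballyElliptic (a b : ℝ) (L : ℝ → ℝ → ℝ → ℝ) : Prop :=
  (∀ x ∈ Icc a b, ∀ u v : ℝ,
    DifferentiableAt ℝ (L x u) v ∧ DifferentiableAt ℝ (deriv (L x u)) v) ∧
  ContinuousOn (fun p : ℝ × ℝ × ℝ => deriv (deriv (L p.1 p.2.1)) p.2.2) (lagDomain a b) ∧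
  ∃ μ > (0 : ℝ), ∀ x ∈ Icc a b, ∀ u v : ℝ, μ ≤ deriv (deriv (L x u)) v

/-- The functional `J_L(u;[a,b]) = ∫_a^b L(x,u(x),u'(x)) dx` with values in `[-∞,∞]`, as the
integral of the positive part minus the integral of the negative part of the integrand.  (The
derivative of an absolutely continuous function exists almost everywhere.  When `L` is continuous
and globally elliptic, the negative part has a finite integral for every `u` in `W^{1,1}`.) -/
noncomputable def functionalJ (a b : ℝ) (L : ℝ → ℝ → ℝ → ℝ) (u : ℝ → ℝ) : EReal :=
  ((∫⁻ x in Icc a b, ENNReal.ofReal (L x (u x) (deriv u x)) : ENNReal) : EReal) -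
    ((∫⁻ x in Icc a b, ENNReal.ofReal (-L x (u x) (deriv u x)) : ENNReal) : EReal)

/-- The admissible class `𝒜_{f,g}` of the obstacle problem, with boundary values `A` and `B`. -/
def admissible (a b A B : ℝ) (f g : ℝ → ℝ) : Set (ℝ → ℝ) :=
  {u | MemW11 a b u ∧ u a = A ∧ u b = B ∧ ∀ x ∈ Icc a b, f x ≤ u x ∧ u x ≤ g x}

/-- The class `𝒮_{f,g}` of solutions (minimizers) of the obstacle problem. -/
def solutions (a b A B : ℝ) (L : ℝ → ℝ → ℝ → ℝ) (f g : ℝ → ℝ) : Set (ℝ → ℝ) :=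
  {u | u ∈ admissible a b A B f g ∧
    ∀ v ∈ admissible a b A B f g, functionalJ a b L u ≤ functionalJ a b L v}

/-- The modulus of continuity of `h : [a,b] → ℝ`. -/
noncomputable def modulus (a b : ℝ) (h : ℝ → ℝ) (ε : ℝ) : ℝ :=
  sSup {r : ℝ | ∃ x ∈ Icc a b, ∃ y ∈ Icc a b, |x - y| ≤ ε ∧ r = |h x - h y|}

/-- `u : [a,b] → ℝ` has at `x` the derivative `d ∈ [-∞,∞]` (one-sided at the endpoints). -/
def HasExtDerivAt (a b : ℝ) (u : ℝ → ℝ) (d : EReal) (x : ℝ) : Prop :=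
  Tendsto (fun y : ℝ => (((u y - u x) / (y - x) : ℝ) : EReal)) (𝓝[Icc a b \ {x}] x) (𝓝 d)

/-- The set `Ω_u` of points of `[a,b]` at which `u : [a,b] → ℝ` is differentiable. -/
def diffSet (a b : ℝ) (u : ℝ → ℝ) : Set ℝ :=
  {x | x ∈ Icc a b ∧ DifferentiableWithinAt ℝ u (Icc a b) x}

/-- Tonelli's partial regularity of `u ∈ W^{1,1}([a,b])`: the set `Ω_u` is relatively open in
`[a,b]`, its complement is the set of points with an infinite derivative, and the derivative is
continuous as a function from `[a,b]` to `[-∞,∞]`. -/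
def TonelliPartialRegularity (a b : ℝ) (u : ℝ → ℝ) : Prop :=
  MemW11 a b u ∧
  (∃ U : Set ℝ, IsOpen U ∧ diffSet a b u = Icc a b ∩ U) ∧
  Icc a b \ diffSet a b u =
    {x | x ∈ Icc a b ∧ (HasExtDerivAt a b u ⊥ x ∨ HasExtDerivAt a b u ⊤ x)} ∧
  ∃ u' : ℝ → EReal, (∀ x ∈ Icc a b, HasExtDerivAt a b u (u' x) x) ∧ ContinuousOn u' (Icc a b)

end ObstacleProblem

/-!
A minimizer is compared, on a short interval `[c,d]`, with the chord of its graph clipped to the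
obstacles (`clipLine`).  The obstacles are `C¹`, so where the chord has to be replaced by an
obstacle the slope of the obstacle differs from the slope `ξ` of the chord by at most the
oscillation `K` of its derivative over `[c,d]` (`clipLine_sub_le`).  Since `L` is uniformly convex
in the velocity, and `L` and `L_v` are Hölder continuous in `(x,u)`, minimality gives
`∫ |u' - ξ| ≤ N (d - c) ((d - c) ^ β + K)` over `[c,d]`, as long as `|ξ|` stays bounded and `d - c`
is small (`exists_abs_sub_chord_le`).  The linear terms disappear because `u' - ξ` and the
corresponding quantity of the competitor have integral zero.

Hence the slope changes by at most `e(d - c)`, with `e(t)` a multiple of `t ^ β + ω_f'(t) + ω_g'(t)`,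
when an interval is replaced by a subinterval of at least half its length.  Halving repeatedly, one
reaches every subinterval, and the total change is at most `∑ e((d - c) / 2 ^ j)`, which is small by
the integral condition on the moduli of `f'` and `g'` (`slopeStable_of_mem_solutions`).

This stability implies partial regularity.  At a point near which the slopes are not all large, an
interval of bounded slope can be enlarged to a neighbourhood of the point, where all slopes are then
almost equal; otherwise all slopes near the point tend to `+∞` or all to `-∞`, by connectedness
(`exists_tendsto_slope_nhds`).  So the slopes of `[c,d]` converge in `[-∞,∞]` as `c` and `d` tend to
a common point, and a limit of this kind is automatically a continuous extended derivative
(`tonelliPartialRegularity_of_slopeStable`).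
-/

namespace ObstacleProblem

/-! ### Moduli of continuity -/

lemma modulus_nonneg (a b : ℝ) (h : ℝ → ℝ) (ε : ℝ) : 0 ≤ modulus a b h ε := by
  refine Real.sSup_nonneg ?_
  rintro r ⟨x, -, y, -, -, rfl⟩
  exact abs_nonneg _

lemma abs_sub_le_modulus {a b : ℝ} {h : ℝ → ℝ} (hh : ContinuousOn h (Icc a b)) {ε x y : ℝ}
    (hx : x ∈ Icc a b) (hy : y ∈ Icc a b) (hxy : |x - y| ≤ ε) :
    |h x - h y| ≤ modulus a b h ε := by
  obtain ⟨C, hC⟩ := isCompact_Icc.exists_bound_of_continuousOn hh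
  refine le_csSup ⟨C + C, ?_⟩ ⟨x, hx, y, hy, hxy, rfl⟩
  rintro r ⟨x, hx, y, hy, -, rfl⟩
  exact (abs_sub _ _).trans (add_le_add (hC x hx) (hC y hy))

lemma modulus_mono {a b : ℝ} {h : ℝ → ℝ} (hh : ContinuousOn h (Icc a b)) :
    Monotone (modulus a b h) := by
  intro ε ε' hε
  refine Real.sSup_le ?_ (modulus_nonneg _ _ _ _)
  rintro r ⟨x, hx, y, hy, hxy, rfl⟩
  exact abs_sub_le_modulus hh hx hy (hxy.trans hε)

/-! ### Affine functions clipped to the obstacles -/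

/-- The bound from above in `abs_max_zero_sub_max_zero_le`; the bound from below follows from it by
reflecting the interval. -/
lemma max_zero_sub_max_zero_le {c d K : ℝ} {F F' : ℝ → ℝ}
    (hF : ∀ x ∈ Icc c d, HasDerivWithinAt F (F' x) (Icc c d) x)
    (hF' : ∀ x ∈ Icc c d, ∀ y ∈ Icc c d, F' x - F' y ≤ K) (hK : 0 ≤ K) (hd : F d ≤ 0)
    {x y : ℝ} (hx : c ≤ x) (hxy : x ≤ y) (hy : y ≤ d) :
    max (F y) 0 - max (F x) 0 ≤ K * (y - x) := by
  have hK' : 0 ≤ K * (y - x) := mul_nonneg hK (by linarith)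
  rcases le_or_gt (max (F y) 0) (max (F x) 0) with h | h
  · linarith
  have hcont : ContinuousOn F (Icc c d) := fun z hz => (hF z hz).continuousWithinAt
  have hmvt : ∀ p q, c ≤ p → p < q → q ≤ d → ∃ z ∈ Icc c d, F' z * (q - p) = F q - F p := by
    intro p q hp hpq hq
    obtain ⟨z, hz, hz'⟩ := exists_hasDerivAt_eq_slope F F' hpq
      (hcont.mono (Icc_subset_Icc hp hq)) (fun z hz =>
        (hF z ⟨hp.trans hz.1.le, hz.2.le.trans hq⟩).hasDerivAt
          (Icc_mem_nhds (hp.trans_lt hz.1) (hz.2.trans_le hq)))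
    refine ⟨z, ⟨hp.trans hz.1.le, hz.2.le.trans hq⟩, ?_⟩
    rw [hz', div_mul_cancel₀ _ (by linarith)]
  have hFy : 0 < F y := by
    by_contra hn
    rw [max_eq_right (not_lt.1 hn)] at h
    exact absurd h (not_lt.2 (le_max_right _ _))
  rw [max_eq_left hFy.le] at h ⊢
  obtain ⟨x', ⟨hxx', hx'y⟩, hx'⟩ : ∃ x' ∈ Icc x y, F x' = max (F x) 0 := by
    have := intermediate_value_Icc hxy (hcont.mono (Icc_subset_Icc hx hy))
    exact this ⟨le_max_left _ _, h.le⟩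
  have hlt : x' < y := by
    rcases hx'y.lt_or_eq with h' | rfl
    · exact h'
    · rw [hx'] at h; exact absurd h (lt_irrefl _)
  have hyd : y < d := by
    rcases hy.lt_or_eq with h' | rfl
    · exact h'
    · linarith
  obtain ⟨z₁, hz₁, e₁⟩ := hmvt x' y (hx.trans hxx') hlt hy
  obtain ⟨z₂, hz₂, e₂⟩ := hmvt y d (hx.trans hxy) hyd le_rfl
  -- The graph of `F` has to come down from `F y > 0` to `F d ≤ 0`, so `F'` is negative somewhere.
  have hneg : F' z₂ ≤ 0 := by
    by_contra hn
    have : 0 < F' z₂ * (d - y) := mul_pos (not_le.1 hn) (by linarith)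
    linarith
  have h1 : F' z₁ ≤ K := by linarith [hF' z₁ hz₁ z₂ hz₂]
  rw [← hx', ← e₁]
  calc F' z₁ * (y - x') ≤ K * (y - x') := mul_le_mul_of_nonneg_right h1 (by linarith)
    _ ≤ K * (y - x) := mul_le_mul_of_nonneg_left (by linarith) hK

/-- The positive part of a `C¹` function that is nonpositive at both ends of an interval is
Lipschitz, with the oscillation of the derivative as constant: wherever the function is positive,
its derivative is compared with derivatives of either sign. -/
lemma abs_max_zero_sub_max_zero_le {c d K : ℝ} {F F' : ℝ → ℝ}
    (hF : ∀ x ∈ Icc c d, HasDerivWithinAt F (F' x) (Icc c d) x)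
    (hF' : ∀ x ∈ Icc c d, ∀ y ∈ Icc c d, |F' x - F' y| ≤ K) (hc : F c ≤ 0) (hd : F d ≤ 0)
    {x y : ℝ} (hx : x ∈ Icc c d) (hy : y ∈ Icc c d) :
    |max (F x) 0 - max (F y) 0| ≤ K * |x - y| := by
  wlog hxy : x ≤ y generalizing x y
  · rw [abs_sub_comm, abs_sub_comm x]
    exact this hy hx (not_le.1 hxy).le
  have hK : 0 ≤ K := (abs_nonneg _).trans (hF' x hx x hx)
  have h1 := max_zero_sub_max_zero_le hF
    (fun x hx y hy => (le_abs_self _).trans (hF' x hx y hy)) hK hd hx.1 hxy hy.2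
  have hmaps : MapsTo (fun t => c + d - t) (Icc c d) (Icc c d) := by
    intro t ht
    constructor <;> linarith [ht.1, ht.2]
  have h2 := max_zero_sub_max_zero_le (F := fun t => F (c + d - t))
    (F' := fun t => -F' (c + d - t)) (c := c) (d := d) (K := K)
    (fun t ht => by
      have h := (hF _ (hmaps ht)).comp t
        (((hasDerivAt_id t).const_sub (c + d)).hasDerivWithinAt) hmaps
      simpa [Function.comp_def] using h)
    (fun x hx y hy => by
      have := hF' _ (hmaps hx) _ (hmaps hy)
      rw [abs_sub_comm] at this
      have := (le_abs_self _).trans this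
      linarith) hK (by simpa using hc)
    (x := c + d - y) (y := c + d - x) (by linarith [hy.2]) (by linarith) (by linarith [hx.1])
  simp only [sub_sub_cancel] at h2
  rw [abs_sub_comm x, abs_of_nonneg (by linarith : 0 ≤ y - x), abs_le]
  constructor <;> linarith

/-- The affine function `ℓ`, clipped from below by `f` and from above by `g`, for `f ≤ g`.  It is
written as a sum of positive parts so that its distance from `ℓ` is visible. -/
noncomputable def clipLine (f g ℓ : ℝ → ℝ) (x : ℝ) : ℝ :=
  ℓ x + max (f x - ℓ x) 0 - max (ℓ x - g x) 0

lemma clipLine_mem_Icc {f g ℓ : ℝ → ℝ} {x : ℝ} (h : f x ≤ g x) :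
    clipLine f g ℓ x ∈ Icc (f x) (g x) := by
  unfold clipLine
  constructor <;> rcases max_cases (f x - ℓ x) 0 with h1 | h1 <;>
    rcases max_cases (ℓ x - g x) 0 with h2 | h2 <;> linarith [h1.1, h1.2, h2.1, h2.2]

lemma clipLine_eq_of_mem_Icc {f g ℓ : ℝ → ℝ} {x : ℝ} (h : ℓ x ∈ Icc (f x) (g x)) :
    clipLine f g ℓ x = ℓ x := by
  unfold clipLine
  rw [max_eq_right (by linarith [h.1]), max_eq_right (by linarith [h.2])]
  ring

lemma clipLine_sub_le {a b : ℝ} (hab : a < b) {f g : ℝ → ℝ}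
    (hf : ContDiffOn ℝ 1 f (Icc a b)) (hg : ContDiffOn ℝ 1 g (Icc a b)) {c d y₀ ξ : ℝ}
    (hc : a ≤ c) (hd : d ≤ b)
    (hℓc : y₀ ∈ Icc (f c) (g c)) (hℓd : y₀ + ξ * (d - c) ∈ Icc (f d) (g d))
    {x y : ℝ} (hx : x ∈ Icc c d) (hy : y ∈ Icc c d) :
    |clipLine f g (fun t => y₀ + ξ * (t - c)) x - clipLine f g (fun t => y₀ + ξ * (t - c)) y
        - ξ * (x - y)| ≤
      (modulus a b (derivWithin f (Icc a b)) (d - c) +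
        modulus a b (derivWithin g (Icc a b)) (d - c)) * |x - y| := by
  have hsub : Icc c d ⊆ Icc a b := Icc_subset_Icc hc hd
  have hder : ∀ {h : ℝ → ℝ}, ContDiffOn ℝ 1 h (Icc a b) → ∀ x ∈ Icc c d,
      HasDerivWithinAt h (derivWithin h (Icc a b) x) (Icc c d) x := fun hh x hx =>
    ((hh.differentiableOn one_ne_zero x (hsub hx)).hasDerivWithinAt).mono hsub
  have hosc : ∀ {h : ℝ → ℝ}, ContDiffOn ℝ 1 h (Icc a b) → ∀ x ∈ Icc c d, ∀ y ∈ Icc c d,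
      |derivWithin h (Icc a b) x - derivWithin h (Icc a b) y| ≤
        modulus a b (derivWithin h (Icc a b)) (d - c) := fun hh x hx y hy =>
    abs_sub_le_modulus (hh.continuousOn_derivWithin (uniqueDiffOn_Icc hab) le_rfl)
      (hsub hx) (hsub hy) (abs_le.2 ⟨by linarith [hx.1, hy.2], by linarith [hx.2, hy.1]⟩)
  have hl : ∀ x, HasDerivWithinAt (fun t => y₀ + ξ * (t - c)) ξ (Icc c d) x := fun x => by
    have := ((((hasDerivAt_id x).sub_const c).const_mul ξ).const_add y₀).hasDerivWithinAt
      (s := Icc c d)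
    simpa using this
  have h1 := abs_max_zero_sub_max_zero_le (F := fun t => f t - (y₀ + ξ * (t - c)))
    (F' := fun t => derivWithin f (Icc a b) t - ξ)
    (fun x hx => (hder hf x hx).sub (hl x))
    (fun x hx y hy => by simpa using hosc hf x hx y hy)
    (by simpa using hℓc.1) (by simpa using hℓd.1) hx hy
  have h2 := abs_max_zero_sub_max_zero_le (F := fun t => (y₀ + ξ * (t - c)) - g t)
    (F' := fun t => ξ - derivWithin g (Icc a b) t)
    (fun x hx => (hl x).sub (hder hg x hx))
    (fun x hx y hy => by
      have := hosc hg x hx y hy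
      rw [abs_sub_comm] at this
      simpa using this)
    (by simpa using hℓc.2) (by simpa using hℓd.2) hx hy
  rw [add_mul]
  refine le_trans (le_of_eq ?_) ((abs_sub _ _).trans (add_le_add h1 h2))
  unfold clipLine
  congr 1
  ring

/-! ### Absolutely continuous functions -/

/-- The nearest-point retraction of the line onto `[c,d]`. -/
noncomputable def clampTo (c d x : ℝ) : ℝ := max c (min d x)

lemma clampTo_mem {c d : ℝ} (hcd : c ≤ d) (x : ℝ) : clampTo c d x ∈ Icc c d :=
  ⟨le_max_left _ _, max_le hcd (min_le_left _ _)⟩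

lemma clampTo_of_mem {c d x : ℝ} (hx : x ∈ Icc c d) : clampTo c d x = x := by
  simp [clampTo, hx.1, hx.2]

lemma clampTo_of_le {c d x : ℝ} (hx : x ≤ c) : clampTo c d x = c :=
  max_eq_left ((min_le_right _ _).trans hx)

lemma clampTo_of_ge {c d x : ℝ} (hcd : c ≤ d) (hx : d ≤ x) : clampTo c d x = d := by
  simp [clampTo, hx, hcd]

lemma _root_.AbsolutelyContinuousOnInterval.comp_clampTo {h : ℝ → ℝ} {a b c d : ℝ} (hcd : c ≤ d)
    (hh : AbsolutelyContinuousOnInterval h c d) :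
    AbsolutelyContinuousOnInterval (fun x => h (clampTo c d x)) a b := by
  rw [absolutelyContinuousOnInterval_iff] at hh ⊢
  intro ε hε
  obtain ⟨δ, hδ, H⟩ := hh ε hε
  refine ⟨δ, hδ, fun E hE hEδ => ?_⟩
  refine H (E.1, fun i => (clampTo c d (E.2 i).1, clampTo c d (E.2 i).2)) ⟨?_, ?_⟩ ?_
  · intro i _
    rw [uIcc_of_le hcd]
    exact ⟨clampTo_mem hcd _, clampTo_mem hcd _⟩
  · refine hE.2.mono fun i z hz => ?_
    simp only [clampTo, mem_uIoc] at hz ⊢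
    grind
  · refine lt_of_le_of_lt (Finset.sum_le_sum fun i _ => ?_) hEδ
    simp only [Real.dist_eq, clampTo]
    refine (abs_max_sub_max_le_max c _ c _).trans (max_le (by simp) ?_)
    exact (abs_min_sub_min_le_max d _ d _).trans (max_le (by simp) le_rfl)

/-- If `h - ξ · id` has Lipschitz constant `K` near `x`, then `h'(x)` is within `K` of `ξ`. -/
lemma abs_deriv_sub_le {h : ℝ → ℝ} {c d K ξ x : ℝ}
    (hK : ∀ x ∈ Icc c d, ∀ y ∈ Icc c d, |h x - h y - ξ * (x - y)| ≤ K * |x - y|)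
    (hx : x ∈ Ioo c d) (hd : DifferentiableAt ℝ h x) : |deriv h x - ξ| ≤ K := by
  have hK0 : 0 ≤ K := by
    have h1 := (abs_nonneg _).trans (hK c ⟨le_rfl, (hx.1.trans hx.2).le⟩ d
      ⟨(hx.1.trans hx.2).le, le_rfl⟩)
    exact nonneg_of_mul_nonneg_left h1 (abs_pos.2 (by linarith [hx.1, hx.2]))
  have h1 : HasDerivAt (fun t => h t - ξ * t) (deriv h x - ξ) x := by
    simpa using hd.hasDerivAt.fun_sub ((hasDerivAt_id x).const_mul ξ)
  refine h1.le_of_lip' hK0 ?_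
  filter_upwards [Icc_mem_nhds hx.1 hx.2] with y hy
  have := hK y hy x (Ioo_subset_Icc_self hx)
  rw [Real.norm_eq_abs, Real.norm_eq_abs]
  refine le_trans (le_of_eq ?_) this
  congr 1
  ring

/-! ### Second order expansion -/

lemma exists_second_order_expansion {G : ℝ → ℝ} (h1 : Differentiable ℝ G)
    (h2 : Differentiable ℝ (deriv G)) (h3 : Continuous (deriv (deriv G))) (v p : ℝ) :
    ∃ z ∈ uIcc v p, G p = G v + deriv G v * (p - v) + deriv (deriv G) z / 2 * (p - v) ^ 2 := by
  rcases eq_or_ne v p with rfl | hne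
  · exact ⟨v, left_mem_uIcc, by simp⟩
  have hC1 : ContDiff ℝ 1 (deriv G) := contDiff_one_iff_deriv.2 ⟨h2, h3⟩
  have hC2 : ContDiff ℝ (1 + 1) G := by
    rw [contDiff_succ_iff_deriv]
    exact ⟨h1, by simp, hC1⟩
  obtain ⟨z, hz, e⟩ := taylor_mean_remainder_lagrange_iteratedDeriv (f := G) (n := 1) hne
    (by exact_mod_cast hC2.contDiffOn)
  refine ⟨z, Ioo_subset_Icc_self hz, ?_⟩
  have hdw : derivWithin G (uIcc v p) v = deriv G v :=
    (h1 v).derivWithin ((uniqueDiffOn_uIcc hne) v left_mem_uIcc)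
  rw [taylorWithinEval_succ, taylor_within_zero_eval, iteratedDeriv_succ, iteratedDeriv_one,
    zero_add, iteratedDerivWithin_one, hdw] at e
  norm_num at e
  linarith

section

/-! ### Bounds for the Lagrangian on a box -/

/-- Quantitative form of the hypotheses on `L` for `x ∈ [a,b]`, `|y| ≤ R` and velocities bounded by
`M`: Hölder continuity of `L` and of `L_v` in `(x,y)`, with exponents `2β` and `β`, and a quadratic
lower and upper bound of the excess of `L` over its tangent in the velocity.  The lower
bound holds for every second velocity `p`. -/
structure BoxBounds (a b : ℝ) (L : ℝ → ℝ → ℝ → ℝ) (R M μ C β : ℝ) : Prop where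
  mu_pos : 0 < μ
  C_pos : 0 < C
  beta_pos : 0 < β
  holder : ∀ x ∈ Icc a b, ∀ x' ∈ Icc a b, ∀ y y' v ρ : ℝ, |y| ≤ R → |y'| ≤ R → |v| ≤ M →
    |x - x'| + |y - y'| ≤ ρ → 0 < ρ → ρ ≤ 1 → |L x y v - L x' y' v| ≤ C * (ρ ^ β) ^ 2
  holder_deriv : ∀ x ∈ Icc a b, ∀ x' ∈ Icc a b, ∀ y y' v ρ : ℝ, |y| ≤ R → |y'| ≤ R → |v| ≤ M →
    |x - x'| + |y - y'| ≤ ρ → 0 < ρ → ρ ≤ 1 →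
      |deriv (L x y) v - deriv (L x' y') v| ≤ C * ρ ^ β
  lower : ∀ x ∈ Icc a b, ∀ y v p : ℝ,
    L x y v + deriv (L x y) v * (p - v) + μ / 2 * (p - v) ^ 2 ≤ L x y p
  upper : ∀ x ∈ Icc a b, ∀ y v p : ℝ, |y| ≤ R → |v| ≤ M → |p| ≤ M →
    L x y p ≤ L x y v + deriv (L x y) v * (p - v) + C * (p - v) ^ 2

variable {a b : ℝ} {L : ℝ → ℝ → ℝ → ℝ}

lemma GloballyElliptic.exists_expansion (hH2 : GloballyElliptic a b L) {x : ℝ} (hx : x ∈ Icc a b)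
    (y v p : ℝ) : ∃ z ∈ uIcc v p, L x y p =
      L x y v + deriv (L x y) v * (p - v) + deriv (deriv (L x y)) z / 2 * (p - v) ^ 2 := by
  refine exists_second_order_expansion (fun v => (hH2.1 x hx y v).1)
    (fun v => (hH2.1 x hx y v).2) ?_ v p
  rw [← continuousOn_univ]
  exact hH2.2.1.comp (f := fun v : ℝ => (x, y, v)) (by fun_prop)
    (fun v _ => ⟨hx, mem_univ _⟩)

lemma abs_le_of_mem_uIcc {v p z M : ℝ} (hz : z ∈ uIcc v p) (hv : |v| ≤ M) (hp : |p| ≤ M) :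
    |z| ≤ M := by
  rw [abs_le] at *
  rw [mem_uIcc] at hz
  constructor <;> rcases hz with h | h <;> linarith [h.1, h.2]

/-- The compact set `[a,b] × [-R,R] × [-M,M]`. -/
def box (a b R M : ℝ) : Set (ℝ × ℝ × ℝ) := Icc a b ×ˢ Icc (-R) R ×ˢ Icc (-M) M

lemma isCompact_box (a b R M : ℝ) : IsCompact (box a b R M) :=
  isCompact_Icc.prod (isCompact_Icc.prod isCompact_Icc)

lemma box_subset (a b R M : ℝ) : box a b R M ⊆ lagDomain a b := fun _ hp => ⟨hp.1, mem_univ _⟩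

lemma exists_boxBounds (hH1 : LocallyHolder a b L) (hH2 : GloballyElliptic a b L) (R M : ℝ) :
    ∃ μ C β : ℝ, BoxBounds a b L R M μ C β := by
  obtain ⟨C, hC, α, hα, hhol⟩ := hH1 (box a b R (M + 1)) (isCompact_box ..) (box_subset ..)
  obtain ⟨Λ, hΛ⟩ := (isCompact_box a b R (M + 1)).exists_bound_of_continuousOn
    (hH2.2.1.mono (box_subset ..))
  obtain ⟨μ, hμ, hmu⟩ := hH2.2.2
  have hΛ' : ∀ x ∈ Icc a b, ∀ y z : ℝ, |y| ≤ R → |z| ≤ M + 1 →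
      |deriv (deriv (L x y)) z| ≤ |Λ| := fun x hx y z hy hz =>
    (hΛ (x, y, z) ⟨hx, abs_le.1 hy, abs_le.1 hz⟩).trans (le_abs_self _)
  have hLh : ∀ x ∈ Icc a b, ∀ x' ∈ Icc a b, ∀ y y' v ρ : ℝ, |y| ≤ R → |y'| ≤ R → |v| ≤ M + 1 →
      |x - x'| + |y - y'| ≤ ρ → 0 < ρ → |L x y v - L x' y' v| ≤ C * (ρ ^ (α / 2)) ^ 2 := by
    intro x hx x' hx' y y' v ρ hy hy' hv hρ hρ0
    have := hhol (x, y, v) ⟨hx, abs_le.1 hy, abs_le.1 hv⟩ (x', y', v)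
      ⟨hx', abs_le.1 hy', abs_le.1 hv⟩
    rw [← Real.rpow_mul_natCast hρ0.le]
    norm_num
    refine this.trans (mul_le_mul_of_nonneg_left ?_ hC.le)
    exact Real.rpow_le_rpow (by positivity) (by simpa using hρ) hα.le
  refine ⟨μ, 2 * C + |Λ|, α / 2, hμ, by positivity, by positivity, ?_, ?_, ?_, ?_⟩
  · intro x hx x' hx' y y' v ρ hy hy' hv hρ hρ0 _
    refine (hLh x hx x' hx' y y' v ρ hy hy' (by linarith) hρ hρ0).trans ?_
    exact mul_le_mul_of_nonneg_right (by linarith [abs_nonneg Λ]) (by positivity)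
  · intro x hx x' hx' y y' v ρ hy hy' hv hρ hρ0 hρ1
    -- Interpolation: compare the derivatives with difference quotients of step `s = ρ ^ (α / 2)`.
    set s := ρ ^ (α / 2) with hs
    have hs0 : 0 < s := Real.rpow_pos_of_pos hρ0 _
    have hs1 : s ≤ 1 := Real.rpow_le_one hρ0.le hρ1 (by positivity)
    have hv1 : |v| ≤ M + 1 := by linarith
    have hvs : |v + s| ≤ M + 1 := (abs_add_le _ _).trans (by rw [abs_of_pos hs0]; linarith)
    obtain ⟨z, hz, e⟩ := hH2.exists_expansion hx y v (v + s)
    obtain ⟨z', hz', e'⟩ := hH2.exists_expansion hx' y' v (v + s)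
    have b1 := abs_le.1 (hLh x hx x' hx' y y' v ρ hy hy' hv1 hρ hρ0)
    have b2 := abs_le.1 (hLh x hx x' hx' y y' (v + s) ρ hy hy' hvs hρ hρ0)
    have b3 := abs_le.1 (hΛ' x hx y z hy (abs_le_of_mem_uIcc hz hv1 hvs))
    have b4 := abs_le.1 (hΛ' x' hx' y' z' hy' (abs_le_of_mem_uIcc hz' hv1 hvs))
    rw [← hs] at b1 b2
    simp only [add_sub_cancel_left] at e e'
    have hs2 : 0 ≤ s ^ 2 := by positivity
    have b5 := mul_le_mul_of_nonneg_right b3.1 hs2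
    have b6 := mul_le_mul_of_nonneg_right b3.2 hs2
    have b7 := mul_le_mul_of_nonneg_right b4.1 hs2
    have b8 := mul_le_mul_of_nonneg_right b4.2 hs2
    have key : |s * (deriv (L x y) v - deriv (L x' y') v)| ≤ s * ((2 * C + |Λ|) * s) := by
      rw [abs_le]
      constructor <;> nlinarith
    rw [abs_mul, abs_of_pos hs0] at key
    exact le_of_mul_le_mul_left key hs0
  · intro x hx y v p
    obtain ⟨z, -, e⟩ := hH2.exists_expansion hx y v p
    have := mul_le_mul_of_nonneg_right (hmu x hx y z) (sq_nonneg (p - v))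
    linarith
  · intro x hx y v p hy hv hp
    obtain ⟨z, hz, e⟩ := hH2.exists_expansion hx y v p
    have b1 := hΛ' x hx y z hy (abs_le_of_mem_uIcc hz (by linarith) (by linarith))
    have b2 := mul_le_mul_of_nonneg_right (abs_le.1 b1).2 (sq_nonneg (p - v))
    have b3 : 0 ≤ |Λ| * (p - v) ^ 2 := by positivity
    have b4 : 0 ≤ C * (p - v) ^ 2 := by positivity
    linarith

/-- The Lagrangian is bounded below for bounded `y`, uniformly in the velocity. -/
lemma exists_lower_bound (hL : LagContinuous a b L) (hH2 : GloballyElliptic a b L) (R : ℝ) :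
    ∃ K : ℝ, ∀ x ∈ Icc a b, ∀ y p : ℝ, |y| ≤ R → -K ≤ L x y p := by
  obtain ⟨Λ, hΛ⟩ := (isCompact_box a b R 1).exists_bound_of_continuousOn
    (hH2.2.1.mono (box_subset ..))
  obtain ⟨C, hC⟩ := (isCompact_box a b R 1).exists_bound_of_continuousOn
    (hL.mono (box_subset ..))
  obtain ⟨μ, hμ, hmu⟩ := hH2.2.2
  refine ⟨C + (2 * C + Λ) ^ 2 / (2 * μ), fun x hx y p hy => ?_⟩
  obtain ⟨z, -, e⟩ := hH2.exists_expansion hx y 0 p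
  obtain ⟨z', hz', e'⟩ := hH2.exists_expansion hx y 0 1
  have h1 := abs_le.1 (hΛ (x, y, z')
    ⟨hx, abs_le.1 hy, abs_le.1 (abs_le_of_mem_uIcc hz' (by simp) (by simp))⟩)
  have h2 := abs_le.1 (hC (x, y, 0) ⟨hx, abs_le.1 hy, by simp⟩)
  have h3 := abs_le.1 (hC (x, y, 1) ⟨hx, abs_le.1 hy, by simp⟩)
  simp only at h1 h2 h3
  simp only [sub_zero, one_pow, mul_one] at e e'
  set P := deriv (L x y) 0
  have hP : P ^ 2 ≤ (2 * C + Λ) ^ 2 := by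
    apply sq_le_sq'
    · linarith [h1.1, h1.2]
    · linarith [h1.1, h1.2]
  have h4 := mul_le_mul_of_nonneg_right (hmu x hx y z) (sq_nonneg p)
  -- Completing the square in `P * p + μ / 2 * p ^ 2`.
  have h5 : -(P ^ 2 / (2 * μ)) ≤ P * p + μ / 2 * p ^ 2 := by
    have : P * p + μ / 2 * p ^ 2 + P ^ 2 / (2 * μ) = (μ * p + P) ^ 2 / (2 * μ) := by
      field_simp
      ring
    have : 0 ≤ (μ * p + P) ^ 2 / (2 * μ) := by positivity
    linarith
  have h6 : P ^ 2 / (2 * μ) ≤ (2 * C + Λ) ^ 2 / (2 * μ) := by gcongr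
  linarith [h2.1]

end

section

/-! ### Energies and local minimality -/

/-- The integrand `x ↦ L(x,u(x),u'(x))` of the functional. -/
noncomputable def lagAlong (L : ℝ → ℝ → ℝ → ℝ) (u : ℝ → ℝ) (x : ℝ) : ℝ := L x (u x) (deriv u x)

variable {a b : ℝ} {L : ℝ → ℝ → ℝ → ℝ}

lemma aestronglyMeasurable_lagAlong (hab : a ≤ b) (hL : LagContinuous a b L) {u : ℝ → ℝ} {c d : ℝ}
    (hc : a ≤ c) (hd : d ≤ b) (hu : ContinuousOn u (Icc c d)) :
    AEStronglyMeasurable (lagAlong L u) (volume.restrict (Icc c d)) := by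
  have hcont : Continuous (fun p : ℝ × ℝ × ℝ => L (clampTo a b p.1) p.2.1 p.2.2) := by
    rw [← continuousOn_univ]
    refine hL.comp (f := fun p : ℝ × ℝ × ℝ => (clampTo a b p.1, p.2.1, p.2.2)) ?_
      (fun p _ => ⟨clampTo_mem hab _, mem_univ _⟩)
    unfold clampTo
    fun_prop
  have h := hcont.comp_aestronglyMeasurable
    (f := fun x : ℝ => (x, u x, deriv u x)) (μ := volume.restrict (Icc c d))
    (aestronglyMeasurable_id.prodMk ((hu.aestronglyMeasurable measurableSet_Icc).prodMk
      (measurable_deriv u).aestronglyMeasurable))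
  refine h.congr ?_
  filter_upwards [ae_restrict_mem measurableSet_Icc] with x hx
  simp only [lagAlong]
  rw [clampTo_of_mem ⟨hc.trans hx.1, hx.2.trans hd⟩]

lemma integrableOn_lagAlong_of_bounded (hab : a ≤ b) (hL : LagContinuous a b L) {w : ℝ → ℝ}
    {c d M : ℝ} (hc : a ≤ c) (hd : d ≤ b) (hw : ContinuousOn w (Icc c d))
    (hM : ∀ᵐ x ∂volume.restrict (Icc c d), |deriv w x| ≤ M) :
    IntegrableOn (lagAlong L w) (Icc c d) := by
  obtain ⟨R, hR⟩ := isCompact_Icc.exists_bound_of_continuousOn hw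
  obtain ⟨C, hC⟩ := (isCompact_box a b R M).exists_bound_of_continuousOn
    (hL.mono (box_subset ..))
  refine Integrable.of_bound (aestronglyMeasurable_lagAlong hab hL hc hd hw) C ?_
  filter_upwards [hM, ae_restrict_mem measurableSet_Icc] with x hx hxI
  exact hC (x, w x, deriv w x) ⟨⟨hc.trans hxI.1, hxI.2.trans hd⟩, abs_le.1 (hR x hxI), abs_le.1 hx⟩

lemma functionalJ_eq_coe {u : ℝ → ℝ} (h : IntegrableOn (lagAlong L u) (Icc a b)) :
    functionalJ a b L u = ((∫ x in Icc a b, lagAlong L u x : ℝ) : EReal) := by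
  have h1 : (∫⁻ x in Icc a b, ENNReal.ofReal (lagAlong L u x)) ≠ ⊤ := h.lintegral_lt_top.ne
  have h2 : (∫⁻ x in Icc a b, ENNReal.ofReal (-lagAlong L u x)) ≠ ⊤ := h.neg.lintegral_lt_top.ne
  rw [integral_eq_lintegral_pos_part_sub_lintegral_neg_part h, EReal.coe_sub,
    EReal.coe_ennreal_toReal h1, EReal.coe_ennreal_toReal h2]
  rfl

lemma integrableOn_of_functionalJ_lt_top {u : ℝ → ℝ} {K : ℝ}
    (hm : AEStronglyMeasurable (lagAlong L u) (volume.restrict (Icc a b)))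
    (hK : ∀ x ∈ Icc a b, -K ≤ lagAlong L u x) (hJ : functionalJ a b L u < ⊤) :
    IntegrableOn (lagAlong L u) (Icc a b) := by
  have h2 : (∫⁻ x in Icc a b, ENNReal.ofReal (-lagAlong L u x)) ≠ ⊤ := by
    refine ne_of_lt (lt_of_le_of_lt (setLIntegral_mono measurable_const
      (g := fun _ => ENNReal.ofReal K) fun x hx => ?_) ?_)
    · exact ENNReal.ofReal_le_ofReal (by linarith [hK x hx])
    · simp [ENNReal.mul_lt_top]
  have h1 : (∫⁻ x in Icc a b, ENNReal.ofReal (lagAlong L u x)) ≠ ⊤ := by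
    intro h
    refine hJ.ne ?_
    unfold functionalJ
    change ((∫⁻ x in Icc a b, ENNReal.ofReal (lagAlong L u x) : ENNReal) : EReal) -
      ((∫⁻ x in Icc a b, ENNReal.ofReal (-lagAlong L u x) : ENNReal) : EReal) = ⊤
    rw [h, ← EReal.coe_ennreal_toReal h2]
    rfl
  refine ⟨hm, ?_⟩
  have : ∀ r : ℝ, ‖r‖ₑ = ENNReal.ofReal r + ENNReal.ofReal (-r) := fun r => by
    rcases le_total 0 r with hr | hr
    · simp [Real.enorm_eq_ofReal hr, ENNReal.ofReal_of_nonpos (neg_nonpos.2 hr)]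
    · rw [ENNReal.ofReal_of_nonpos hr, zero_add, ← enorm_neg, Real.enorm_eq_ofReal (by linarith)]
  unfold HasFiniteIntegral
  simp_rw [this]
  rw [lintegral_add_left' hm.aemeasurable.ennreal_ofReal]
  exact ENNReal.add_lt_top.2 ⟨h1.lt_top, h2.lt_top⟩

variable {A B : ℝ} {f g u : ℝ → ℝ}

lemma exists_abs_le_of_obstacles (hf : ContinuousOn f (Icc a b)) (hg : ContinuousOn g (Icc a b)) :
    ∃ R : ℝ, ∀ x ∈ Icc a b, ∀ y : ℝ, y ∈ Icc (f x) (g x) → |y| ≤ R := by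
  obtain ⟨R₁, h₁⟩ := isCompact_Icc.exists_bound_of_continuousOn hf
  obtain ⟨R₂, h₂⟩ := isCompact_Icc.exists_bound_of_continuousOn hg
  refine ⟨max R₁ R₂, fun x hx y hy => ?_⟩
  have e₁ := abs_le.1 (h₁ x hx)
  have e₂ := abs_le.1 (h₂ x hx)
  rw [abs_le]
  constructor <;> linarith [hy.1, hy.2, le_max_left R₁ R₂, le_max_right R₁ R₂]

/-- The clipped chord of `u` over `[c,d]` is an admissible competitor on `[c,d]` with almost
constant slope. -/
lemma clipLine_competitor (hab : a < b) (hL : LagContinuous a b L)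
    (hf : ContDiffOn ℝ 1 f (Icc a b)) (hg : ContDiffOn ℝ 1 g (Icc a b)) {c d y₀ ξ K : ℝ}
    (hc : a ≤ c) (hcd : c ≤ d) (hd : d ≤ b)
    (hK : modulus a b (derivWithin f (Icc a b)) (d - c) +
        modulus a b (derivWithin g (Icc a b)) (d - c) ≤ K)
    (hℓc : y₀ ∈ Icc (f c) (g c)) (hℓd : y₀ + ξ * (d - c) ∈ Icc (f d) (g d)) :
    ∃ w : ℝ → ℝ, AbsolutelyContinuousOnInterval w c d ∧ w c = y₀ ∧ w d = y₀ + ξ * (d - c) ∧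
      (∀ x, f x ≤ g x → w x ∈ Icc (f x) (g x)) ∧
      (∀ x ∈ Icc c d, |w x - y₀ - ξ * (x - c)| ≤ K * (x - c)) ∧
      (∀ᵐ x ∂volume.restrict (Icc c d), |deriv w x - ξ| ≤ K) ∧
      IntegrableOn (lagAlong L w) (Icc c d) := by
  set w := clipLine f g (fun t => y₀ + ξ * (t - c)) with hw
  have hlip : ∀ x ∈ Icc c d, ∀ y ∈ Icc c d, |w x - w y - ξ * (x - y)| ≤ K * |x - y| :=
    fun x hx y hy => (clipLine_sub_le hab hf hg hc hd hℓc hℓd hx hy).trans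
      (mul_le_mul_of_nonneg_right hK (abs_nonneg _))
  have hK0 : 0 ≤ K := (add_nonneg (modulus_nonneg ..) (modulus_nonneg ..)).trans hK
  have hwc : w c = y₀ := by
    have : w c = y₀ + ξ * (c - c) := clipLine_eq_of_mem_Icc (by simpa using hℓc)
    simpa using this
  have hac : AbsolutelyContinuousOnInterval w c d := by
    refine LipschitzOnWith.absolutelyContinuousOnInterval (K := (K + |ξ|).toNNReal) ?_
    rw [uIcc_of_le hcd]
    refine LipschitzOnWith.of_dist_le_mul fun x hx y hy => ?_
    rw [Real.coe_toNNReal _ (by positivity), Real.dist_eq, Real.dist_eq, add_mul, ← abs_mul ξ]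
    calc |w x - w y| = |(w x - w y - ξ * (x - y)) + ξ * (x - y)| := by ring_nf
      _ ≤ _ := (abs_add_le _ _).trans (add_le_add_left (hlip x hx y hy) _)
  have hder : ∀ᵐ x ∂volume.restrict (Icc c d), |deriv w x - ξ| ≤ K := by
    rw [restrict_Ioo_eq_restrict_Icc.symm, ae_restrict_iff' measurableSet_Ioo]
    filter_upwards [hac.ae_differentiableAt] with x hx hxI
    exact abs_deriv_sub_le hlip hxI (hx (by rw [uIcc_of_le hcd]; exact Ioo_subset_Icc_self hxI))
  refine ⟨w, hac, hwc, clipLine_eq_of_mem_Icc hℓd, fun x hx => clipLine_mem_Icc hx,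
    fun x hx => ?_, hder, ?_⟩
  · have := hlip x hx c ⟨le_rfl, hcd⟩
    rwa [hwc, abs_of_nonneg (by linarith [hx.1] : 0 ≤ x - c)] at this
  · refine integrableOn_lagAlong_of_bounded (M := K + |ξ|) hab.le hL hc hd
      (by simpa [uIcc_of_le hcd] using hac.continuousOn) ?_
    filter_upwards [hder] with x hx
    calc |deriv w x| = |(deriv w x - ξ) + ξ| := by ring_nf
      _ ≤ _ := (abs_add_le _ _).trans (add_le_add_left hx _)

/-- A solution has finite energy, since the clipped chord over the whole of `[a,b]` has. -/
lemma integrableOn_lagAlong_of_mem_solutions (hab : a < b) (hL : LagContinuous a b L)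
    (hH2 : GloballyElliptic a b L)
    (hf : ContDiffOn ℝ 1 f (Icc a b)) (hg : ContDiffOn ℝ 1 g (Icc a b))
    (hfg : ∀ x ∈ Icc a b, f x < g x) (hu : u ∈ solutions a b A B L f g) :
    IntegrableOn (lagAlong L u) (Icc a b) := by
  obtain ⟨⟨huAC, hua, hub, hufg⟩, hmin⟩ := hu
  have hba : b - a ≠ 0 := by linarith
  obtain ⟨w, hwAC, hwa, hwb, hwfg, -, -, hwint⟩ := clipLine_competitor (K := _) (y₀ := u a)
    (ξ := (u b - u a) / (b - a)) hab hL hf hg le_rfl hab.le le_rfl le_rfl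
    (hufg a (left_mem_Icc.2 hab.le))
    (by rw [div_mul_cancel₀ _ hba]; simpa using hufg b (right_mem_Icc.2 hab.le))
  rw [div_mul_cancel₀ _ hba] at hwb
  have hw : w ∈ admissible a b A B f g :=
    ⟨hwAC, by rw [hwa, hua], by rw [hwb, ← hub]; ring, fun x hx => hwfg x (hfg x hx).le⟩
  have hJ := hmin w hw
  rw [functionalJ_eq_coe hwint] at hJ
  obtain ⟨R, hR⟩ := exists_abs_le_of_obstacles hf.continuousOn hg.continuousOn
  obtain ⟨K, hK⟩ := exists_lower_bound hL hH2 R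
  have hcont : ContinuousOn u (Icc a b) := by simpa [uIcc_of_le hab.le] using huAC.continuousOn
  exact integrableOn_of_functionalJ_lt_top
    (aestronglyMeasurable_lagAlong hab.le hL le_rfl le_rfl hcont)
    (fun x hx => hK x hx _ _ (hR x hx _ (hufg x hx))) (hJ.trans_lt (EReal.coe_lt_top _))

/-- A solution minimizes the energy on every subinterval, with its own boundary values. -/
lemma setIntegral_lagAlong_le_of_mem_solutions (hab : a < b) (hu : u ∈ solutions a b A B L f g)
    (hint : IntegrableOn (lagAlong L u) (Icc a b)) {c d : ℝ} (hc : a ≤ c) (hcd : c < d)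
    (hd : d ≤ b) {w : ℝ → ℝ} (hw : AbsolutelyContinuousOnInterval w c d) (hwc : w c = u c)
    (hwd : w d = u d) (hwfg : ∀ x ∈ Icc c d, w x ∈ Icc (f x) (g x))
    (hwint : IntegrableOn (lagAlong L w) (Icc c d)) :
    ∫ x in Icc c d, lagAlong L u x ≤ ∫ x in Icc c d, lagAlong L w x := by
  obtain ⟨⟨huAC, hua, hub, hufg⟩, hmin⟩ := hu
  -- The competitor equals `w` on `[c,d]` and `u` elsewhere, in a form that is visibly absolutely
  -- continuous.
  set v : ℝ → ℝ := fun x => u x - (u (clampTo c d x) - w (clampTo c d x)) with hv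
  have hsub : Icc c d ⊆ Icc a b := Icc_subset_Icc hc hd
  have hvin : ∀ x ∈ Icc c d, v x = w x := fun x hx => by simp [hv, clampTo_of_mem hx]
  have hvout : ∀ x ∉ Ioo c d, v x = u x := by
    intro x hx
    rcases le_or_gt x c with h | h
    · simp [hv, clampTo_of_le h, hwc]
    · simp [hv, clampTo_of_ge hcd.le (not_lt.1 fun h' => hx ⟨h, h'⟩), hwd]
  have huAC' : AbsolutelyContinuousOnInterval u c d :=
    AbsolutelyContinuousOnInterval.mono huAC (by simpa [uIcc_of_le hab.le, uIcc_of_le hcd.le])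
  have hvAC : MemW11 a b v := AbsolutelyContinuousOnInterval.fun_sub huAC
    (AbsolutelyContinuousOnInterval.comp_clampTo (h := fun x => u x - w x) hcd.le
      (huAC'.fun_sub hw))
  have hvadm : v ∈ admissible a b A B f g := by
    refine ⟨hvAC, ?_, ?_, ?_⟩
    · rw [hvout a fun h => absurd h.1 (not_lt.2 hc), hua]
    · rw [hvout b fun h => absurd h.2 (not_lt.2 hd), hub]
    · intro x hx
      by_cases hxI : x ∈ Icc c d
      · rw [hvin x hxI]; exact hwfg x hxI
      · rw [hvout x fun h => hxI (Ioo_subset_Icc_self h)]; exact hufg x hx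
  have hFin : EqOn (lagAlong L v) (lagAlong L w) (Ioo c d) := by
    intro x hx
    have : v =ᶠ[𝓝 x] w := by
      filter_upwards [Icc_mem_nhds hx.1 hx.2] with y hy using hvin y hy
    simp only [lagAlong, this.deriv_eq, this.eq_of_nhds]
  have hFout : EqOn (lagAlong L v) (lagAlong L u) (Icc a b \ Icc c d) := by
    intro x hx
    have : v =ᶠ[𝓝 x] u := by
      filter_upwards [isClosed_Icc.isOpen_compl.mem_nhds hx.2] with y hy
      exact hvout y fun h => hy (Ioo_subset_Icc_self h)
    simp only [lagAlong, this.deriv_eq, this.eq_of_nhds]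
  have hi1 : IntegrableOn (lagAlong L v) (Icc c d) := by
    rw [integrableOn_Icc_iff_integrableOn_Ioo] at hwint ⊢
    exact hwint.congr_fun hFin.symm measurableSet_Ioo
  have hi2 : IntegrableOn (lagAlong L v) (Icc a b \ Icc c d) :=
    (hint.mono_set sdiff_subset).congr_fun hFout.symm (measurableSet_Icc.diff measurableSet_Icc)
  have hi : IntegrableOn (lagAlong L v) (Icc a b) := by
    have := hi1.union hi2
    rwa [union_sdiff_cancel hsub] at this
  have hJ := hmin v hvadm
  rw [functionalJ_eq_coe hint, functionalJ_eq_coe hi, EReal.coe_le_coe_iff,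
    ← integral_inter_add_sdiff measurableSet_Icc hint,
    ← integral_inter_add_sdiff (s := Icc a b) (t := Icc c d) measurableSet_Icc hi,
    setIntegral_congr_fun (measurableSet_Icc.diff measurableSet_Icc) hFout,
    inter_eq_right.2 hsub, integral_Icc_eq_integral_Ioo (f := lagAlong L v),
    setIntegral_congr_fun measurableSet_Ioo hFin, ← integral_Icc_eq_integral_Ioo] at hJ
  linarith

end

section

/-! ### Distance of a solution from its chords -/

variable {a b : ℝ} {L : ℝ → ℝ → ℝ → ℝ}

/-- Linear control of the velocity excess `|p - ξ|` by the difference of two values of the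
Lagrangian, up to null Lagrangians and an error of order `ρ ^ β + K`.  It comes from uniform
convexity at `p`, smoothness at `q`, Young's inequality, and
`|p - ξ| ≤ l / 2 + (p - ξ) ^ 2 / (2 * l)` with `l = ρ ^ β + K`. -/
lemma BoxBounds.abs_sub_le {R M μ C β : ℝ} (hB : BoxBounds a b L R M μ C β)
    {x x₀ y y₀ z ξ p q ρ K : ℝ} (hx : x ∈ Icc a b) (hx₀ : x₀ ∈ Icc a b) (hy : |y| ≤ R)
    (hy₀ : |y₀| ≤ R) (hz : |z| ≤ R) (hξ : |ξ| ≤ M) (hq : |q| ≤ M) (hqK : |q - ξ| ≤ K)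
    (hρ : 0 < ρ) (hρ1 : ρ ≤ 1) (hxy : |x - x₀| + |y - y₀| ≤ ρ) (hxz : |x - x₀| + |z - y₀| ≤ ρ) :
    |p - ξ| ≤ (ρ ^ β + K) / 2 + 2 / (μ * (ρ ^ β + K)) *
      ((L x y p - L x z q) - deriv (L x₀ y₀) ξ * (p - ξ) + deriv (L x₀ y₀) ξ * (q - ξ) +
        (2 * C + C ^ 2 / μ) * (ρ ^ β + K) ^ 2) := by
  have hs0 : 0 < ρ ^ β := Real.rpow_pos_of_pos hρ _
  have hK : 0 ≤ K := (abs_nonneg _).trans hqK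
  have h1 := hB.lower x hx y ξ p
  have h2 := hB.upper x hx z ξ q hz hξ hq
  have h3 := abs_le.1 (hB.holder x hx x₀ hx₀ y y₀ ξ ρ hy hy₀ hξ hxy hρ hρ1)
  have h4 := abs_le.1 (hB.holder x hx x₀ hx₀ z y₀ ξ ρ hz hy₀ hξ hxz hρ hρ1)
  have h5 := hB.holder_deriv x hx x₀ hx₀ y y₀ ξ ρ hy hy₀ hξ hxy hρ hρ1
  have h6 := hB.holder_deriv x hx x₀ hx₀ z y₀ ξ ρ hz hy₀ hξ hxz hρ hρ1
  have hμ := hB.mu_pos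
  have hC := hB.C_pos
  set s := ρ ^ β
  set P₀ := deriv (L x₀ y₀) ξ
  set P₁ := deriv (L x y) ξ
  set P₂ := deriv (L x z) ξ
  have h7 : |(P₁ - P₀) * (p - ξ)| ≤ C * s * |p - ξ| := by
    rw [abs_mul]; exact mul_le_mul_of_nonneg_right h5 (abs_nonneg _)
  have h8 : |(P₂ - P₀) * (q - ξ)| ≤ C * s * K := by
    rw [abs_mul]; exact mul_le_mul h6 hqK (abs_nonneg _) (by positivity)
  have h9 : C * (q - ξ) ^ 2 ≤ C * K ^ 2 :=
    mul_le_mul_of_nonneg_left (sq_le_sq' (abs_le.1 hqK).1 (abs_le.1 hqK).2) hC.le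
  have h10 : C * s * |p - ξ| ≤ μ / 4 * |p - ξ| ^ 2 + C ^ 2 / μ * s ^ 2 := by
    have : μ / 4 * |p - ξ| ^ 2 + C ^ 2 / μ * s ^ 2 - C * s * |p - ξ| =
        (μ * |p - ξ| / 2 - C * s) ^ 2 / μ := by
      field_simp
      ring
    have : 0 ≤ (μ * |p - ξ| / 2 - C * s) ^ 2 / μ := by positivity
    linarith
  have h7' := (abs_le.1 h7).1
  have h8' := (abs_le.1 h8).2
  have hsq : (p - ξ) ^ 2 = |p - ξ| ^ 2 := (sq_abs _).symm
  set Y := (L x y p - L x z q) - P₀ * (p - ξ) + P₀ * (q - ξ) + (2 * C + C ^ 2 / μ) * (s + K) ^ 2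
    with hY
  have h11 : C ^ 2 / μ * s ^ 2 ≤ C ^ 2 / μ * (s + K) ^ 2 := by
    gcongr
    linarith
  have h12 : 2 * C * s ^ 2 + C * s * K + C * K ^ 2 ≤ 2 * C * (s + K) ^ 2 := by
    have : 0 ≤ C * s * K := by positivity
    have : 0 ≤ C * K ^ 2 := by positivity
    nlinarith
  have h13 : μ / 4 * |p - ξ| ^ 2 ≤ Y := by
    rw [hsq] at h1
    rw [hY]
    linarith
  set l := s + K
  have hl : 0 < l := by positivity
  have h14 : |p - ξ| ≤ l / 2 + |p - ξ| ^ 2 / (2 * l) := by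
    have : l / 2 + |p - ξ| ^ 2 / (2 * l) - |p - ξ| = (|p - ξ| - l) ^ 2 / (2 * l) := by
      field_simp
      ring
    have : 0 ≤ (|p - ξ| - l) ^ 2 / (2 * l) := by positivity
    linarith
  have h15 : |p - ξ| ^ 2 / (2 * l) = 2 / (μ * l) * (μ / 4 * |p - ξ| ^ 2) := by
    field_simp
    ring
  calc |p - ξ| ≤ l / 2 + 2 / (μ * l) * (μ / 4 * |p - ξ| ^ 2) := by rw [← h15]; exact h14
    _ ≤ _ := by gcongr

lemma _root_.AbsolutelyContinuousOnInterval.setIntegral_deriv_sub {h : ℝ → ℝ} {c d ξ : ℝ}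
    (hcd : c ≤ d) (hh : AbsolutelyContinuousOnInterval h c d) :
    IntegrableOn (fun x => deriv h x - ξ) (Icc c d) ∧
      ∫ x in Icc c d, (deriv h x - ξ) = h d - h c - ξ * (d - c) := by
  have hi : IntegrableOn (deriv h) (Icc c d) :=
    (intervalIntegrable_iff_integrableOn_Icc_of_le hcd).1 hh.intervalIntegrable_deriv
  have hi' : IntegrableOn (fun _ : ℝ => ξ) (Icc c d) := integrableOn_const (by simp)
  refine ⟨hi.sub hi', ?_⟩
  rw [integral_sub hi hi', integral_Icc_eq_integral_Ioc, ← intervalIntegral.integral_of_le hcd,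
    hh.integral_deriv_eq_sub]
  simp [hcd, mul_comm]

variable {A B : ℝ} {f g u : ℝ → ℝ}

/-- On an interval where `u` and its competitor stay `ρ`-close to `(c, u(c))`, the solution is close
to its chord. -/
lemma abs_sub_chord_le_of_close (hab : a < b) {R M μ C β : ℝ} (hB : BoxBounds a b L R M μ C β)
    (hR : ∀ x ∈ Icc a b, ∀ y : ℝ, y ∈ Icc (f x) (g x) → |y| ≤ R)
    (hu : u ∈ solutions a b A B L f g)
    (hint : IntegrableOn (lagAlong L u) (Icc a b)) {c d ξ K ρ : ℝ} (hc : a ≤ c) (hcd : c < d)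
    (hd : d ≤ b) (hξ : |ξ| + K ≤ M) (hud : u d = u c + ξ * (d - c)) (hρ : 0 < ρ) (hρ1 : ρ ≤ 1)
    (hclose : ∀ x ∈ Icc c d, |x - c| + |u x - u c| ≤ ρ) {w : ℝ → ℝ}
    (hw : AbsolutelyContinuousOnInterval w c d) (hwc : w c = u c)
    (hwd : w d = u d) (hwfg : ∀ x ∈ Icc c d, w x ∈ Icc (f x) (g x))
    (hwclose : ∀ x ∈ Icc c d, |x - c| + |w x - u c| ≤ ρ) (hK : 0 ≤ K)
    (hwK : ∀ᵐ x ∂volume.restrict (Icc c d), |deriv w x - ξ| ≤ K)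
    (hwint : IntegrableOn (lagAlong L w) (Icc c d)) {x : ℝ} (hx : x ∈ Icc c d) :
    |u x - u c - ξ * (x - c)| ≤
      (1 / 2 + 2 / μ * (2 * C + C ^ 2 / μ)) * ((d - c) * (ρ ^ β + K)) := by
  have hsub : Icc c d ⊆ Icc a b := Icc_subset_Icc hc hd
  have hle := setIntegral_lagAlong_le_of_mem_solutions hab hu hint hc hcd hd hw hwc hwd hwfg hwint
  obtain ⟨⟨huAC, -, -, hufg⟩, -⟩ := hu
  have huAC' : ∀ x ∈ Icc c d, AbsolutelyContinuousOnInterval u c x := fun x hx =>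
    AbsolutelyContinuousOnInterval.mono huAC (by
      rw [uIcc_of_le hab.le, uIcc_of_le hx.1]
      exact Icc_subset_Icc hc (hx.2.trans hd))
  obtain ⟨hui, hu0⟩ :=
    (huAC' d (right_mem_Icc.2 hcd.le)).setIntegral_deriv_sub (ξ := ξ) hcd.le
  obtain ⟨hwi, hw0⟩ := hw.setIntegral_deriv_sub (ξ := ξ) hcd.le
  rw [hud] at hu0
  rw [hwd, hwc, hud] at hw0
  have hui' := hint.mono_set hsub
  have hl : 0 < ρ ^ β + K := add_pos_of_pos_of_nonneg (Real.rpow_pos_of_pos hρ _) hK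
  have hμ := hB.mu_pos
  set l := ρ ^ β + K with hl_def
  set P₀ := deriv (L c (u c)) ξ with hP₀
  set D := 2 * C + C ^ 2 / μ with hD
  set Y : ℝ → ℝ := fun x => l / 2 + 2 / (μ * l) * ((lagAlong L u x - lagAlong L w x) -
    P₀ * (deriv u x - ξ) + P₀ * (deriv w x - ξ) + D * l ^ 2) with hY
  have hconst : ∀ r : ℝ, IntegrableOn (fun _ : ℝ => r) (Icc c d) :=
    fun r => integrableOn_const (by simp)
  have i1 : IntegrableOn (fun x => lagAlong L u x - lagAlong L w x) (Icc c d) := hui'.sub hwint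
  have i2 : IntegrableOn (fun x => lagAlong L u x - lagAlong L w x - P₀ * (deriv u x - ξ))
    (Icc c d) := i1.sub (hui.const_mul P₀)
  have i3 : IntegrableOn (fun x => lagAlong L u x - lagAlong L w x - P₀ * (deriv u x - ξ) +
    P₀ * (deriv w x - ξ)) (Icc c d) := i2.add (hwi.const_mul P₀)
  have i4 : IntegrableOn (fun x => lagAlong L u x - lagAlong L w x - P₀ * (deriv u x - ξ) +
    P₀ * (deriv w x - ξ) + D * l ^ 2) (Icc c d) := i3.add (hconst _)
  have hYi : IntegrableOn Y (Icc c d) := (hconst _).add (i4.const_mul _)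
  have hbound : ∫ x in Icc c d, |deriv u x - ξ| ≤ ∫ x in Icc c d, Y x := by
    refine integral_mono_ae hui.abs hYi ?_
    filter_upwards [hwK, ae_restrict_mem measurableSet_Icc] with x hxK hxI
    have hcI : c ∈ Icc a b := hsub (left_mem_Icc.2 hcd.le)
    refine hB.abs_sub_le (hsub hxI) hcI (hR x (hsub hxI) _ (hufg x (hsub hxI)))
      (hR c hcI _ (hufg c hcI)) (hR x (hsub hxI) _ (hwfg x hxI)) (by linarith) ?_ hxK hρ hρ1
      (hclose x hxI) (hwclose x hxI)
    calc |deriv w x| = |(deriv w x - ξ) + ξ| := by ring_nf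
      _ ≤ K + |ξ| := (abs_add_le _ _).trans (add_le_add_left hxK _)
      _ ≤ M := by linarith
  have hYint : ∫ x in Icc c d, Y x = (d - c) * (l / 2) + 2 / (μ * l) *
      ((∫ x in Icc c d, lagAlong L u x) - (∫ x in Icc c d, lagAlong L w x) +
        (d - c) * (D * l ^ 2)) := by
    have hvol : volume.real (Icc c d) = d - c := by simp [hcd.le]
    simp only [hY]
    rw [integral_add (hconst _) (i4.const_mul _), integral_const_mul, integral_add i3 (hconst _),
      integral_add i2 (hwi.const_mul P₀), integral_sub i1 (hui.const_mul P₀),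
      integral_sub hui' hwint, integral_const_mul, integral_const_mul, hu0, hw0,
      setIntegral_const, setIntegral_const, hvol]
    simp
  have hYle : ∫ x in Icc c d, Y x ≤ (1 / 2 + 2 / μ * D) * ((d - c) * l) := by
    rw [hYint]
    have : 2 / (μ * l) * ((∫ x in Icc c d, lagAlong L u x) - (∫ x in Icc c d, lagAlong L w x) +
        (d - c) * (D * l ^ 2)) ≤ 2 / (μ * l) * ((d - c) * (D * l ^ 2)) := by
      gcongr
      linarith
    have e : 2 / (μ * l) * ((d - c) * (D * l ^ 2)) = 2 / μ * D * ((d - c) * l) := by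
      field_simp
    linarith
  obtain ⟨hxi, hx0⟩ := (huAC' x hx).setIntegral_deriv_sub (ξ := ξ) hx.1
  rw [← hx0]
  calc |∫ t in Icc c x, (deriv u t - ξ)| ≤ ∫ t in Icc c x, |deriv u t - ξ| :=
        abs_integral_le_integral_abs
    _ ≤ ∫ t in Icc c d, |deriv u t - ξ| :=
        setIntegral_mono_set hui.abs (ae_of_all _ fun t => abs_nonneg _)
          (Icc_subset_Icc_right hx.2).eventuallyLE
    _ ≤ _ := hbound.trans hYle

/-- The sum of the moduli of continuity of the derivatives of the two obstacles. -/
noncomputable def obstacleModulus (a b : ℝ) (f g : ℝ → ℝ) (t : ℝ) : ℝ :=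
  modulus a b (derivWithin f (Icc a b)) t + modulus a b (derivWithin g (Icc a b)) t

lemma obstacleModulus_nonneg (a b : ℝ) (f g : ℝ → ℝ) (t : ℝ) : 0 ≤ obstacleModulus a b f g t :=
  add_nonneg (modulus_nonneg ..) (modulus_nonneg ..)

lemma obstacleModulus_mono (hab : a < b)
    (hf : ContDiffOn ℝ 1 f (Icc a b)) (hg : ContDiffOn ℝ 1 g (Icc a b)) :
    Monotone (obstacleModulus a b f g) :=
  (modulus_mono (hf.continuousOn_derivWithin (uniqueDiffOn_Icc hab) le_rfl)).add
    (modulus_mono (hg.continuousOn_derivWithin (uniqueDiffOn_Icc hab) le_rfl))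

/-- A solution deviates from its chord over a short interval `[c,d]` of bounded slope by
`o(d - c)`, with an explicit rate.  The estimate for close intervals is used twice: the uniform
continuity of `u` gives closeness `1`, hence a bound `|u(x) - u(c)| ≤ Q (d - c)`, which is
closeness of order `d - c`. -/
lemma exists_abs_sub_chord_le (hab : a < b) (hL : LagContinuous a b L)
    (hH1 : LocallyHolder a b L) (hH2 : GloballyElliptic a b L)
    (hf : ContDiffOn ℝ 1 f (Icc a b)) (hg : ContDiffOn ℝ 1 g (Icc a b))
    (hfg : ∀ x ∈ Icc a b, f x < g x) (hu : u ∈ solutions a b A B L f g) (M : ℝ) :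
    ∃ N > (0 : ℝ), ∃ β > (0 : ℝ), ∃ ε > (0 : ℝ), ∀ c d ξ : ℝ, a ≤ c →
      c < d → d ≤ b → d - c ≤ ε → |ξ| ≤ M →
      u d = u c + ξ * (d - c) → ∀ x ∈ Icc c d, |u x - u c - ξ * (x - c)| ≤
        N * ((d - c) * ((d - c) ^ β + obstacleModulus a b f g (d - c))) := by
  obtain ⟨R, hR⟩ := exists_abs_le_of_obstacles hf.continuousOn hg.continuousOn
  set K₀ := obstacleModulus a b f g (b - a) with hK₀
  have hK₀0 : 0 ≤ K₀ := obstacleModulus_nonneg ..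
  obtain ⟨μ, C, β, hB⟩ := exists_boxBounds hH1 hH2 R (M + K₀)
  have hint := integrableOn_lagAlong_of_mem_solutions hab hL hH2 hf hg hfg hu
  have hμ := hB.mu_pos
  have hC := hB.C_pos
  have hβ := hB.beta_pos
  set E := 1 / 2 + 2 / μ * (2 * C + C ^ 2 / μ) with hE
  have hE0 : 0 < E := by positivity
  set Q := 1 + |M| + K₀ + E * (1 + K₀) with hQ
  have hQ1 : 1 ≤ Q := by
    have : 0 ≤ E * (1 + K₀) := by positivity
    linarith [abs_nonneg M]
  have hucont : UniformContinuousOn u (Icc a b) := by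
    have := AbsolutelyContinuousOnInterval.uniformContinuousOn hu.1.1
    rwa [uIcc_of_le hab.le] at this
  obtain ⟨δ, hδ, hδu⟩ := Metric.uniformContinuousOn_iff.1 hucont (1 / 2) (by norm_num)
  refine ⟨E * Q ^ β + E, by positivity, β, hβ, min (δ / 2) (1 / (2 * Q)), by positivity,
    fun c d ξ hc hcd hd hε hξ hud x hx => ?_⟩
  have hε1 : d - c ≤ δ / 2 := hε.trans (min_le_left _ _)
  have hε2 : Q * (d - c) ≤ 1 / 2 := by
    have := mul_le_mul_of_nonneg_left (hε.trans (min_le_right _ _)) (by linarith : 0 ≤ Q)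
    refine this.trans (le_of_eq ?_)
    field_simp
  have hdc : 0 < d - c := by linarith
  have hsub : Icc c d ⊆ Icc a b := Icc_subset_Icc hc hd
  have hcI : c ∈ Icc a b := hsub (left_mem_Icc.2 hcd.le)
  have hufg := hu.1.2.2.2
  set K := obstacleModulus a b f g (d - c) with hK
  have hK0 : 0 ≤ K := obstacleModulus_nonneg ..
  have hKK₀ : K ≤ K₀ := obstacleModulus_mono hab hf hg (by linarith)
  obtain ⟨w, hwAC, hwc, hwd, hwfg, hwdev, hwK, hwint⟩ := clipLine_competitor hab hL hf hg hc
    hcd.le hd (K := K) le_rfl (hufg c hcI)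
    (by rw [← hud]; exact hufg d (hsub (right_mem_Icc.2 hcd.le)))
  rw [← hud] at hwd
  have hξ' : |ξ| ≤ |M| := hξ.trans (le_abs_self M)
  have hlin : ∀ x ∈ Icc c d, |ξ * (x - c)| ≤ |M| * (d - c) := fun x hx => by
    rw [abs_mul, abs_of_nonneg (by linarith [hx.1] : 0 ≤ x - c)]
    exact mul_le_mul hξ' (by linarith [hx.2]) (by linarith [hx.1]) (abs_nonneg _)
  have hxc : ∀ x ∈ Icc c d, |x - c| ≤ d - c := fun x hx => by
    rw [abs_of_nonneg (by linarith [hx.1])]; linarith [hx.2]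
  have hwlin : ∀ x ∈ Icc c d, |x - c| + |w x - u c| ≤ Q * (d - c) := by
    intro x hx
    have h1 : |w x - u c| ≤ K * (x - c) + |M| * (d - c) := by
      calc |w x - u c| = |(w x - u c - ξ * (x - c)) + ξ * (x - c)| := by ring_nf
        _ ≤ _ := (abs_add_le _ _).trans (add_le_add (hwdev x hx) (hlin x hx))
    have h2 : K * (x - c) ≤ K₀ * (d - c) :=
      mul_le_mul hKK₀ (by linarith [hx.2]) (by linarith [hx.1]) hK₀0
    have h3 : 0 ≤ E * (1 + K₀) * (d - c) := by positivity
    have h4 := hxc x hx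
    rw [hQ]
    linarith
  have step : ∀ ρ, 0 < ρ → ρ ≤ 1 → Q * (d - c) ≤ ρ →
      (∀ x ∈ Icc c d, |x - c| + |u x - u c| ≤ ρ) → ∀ x ∈ Icc c d,
      |u x - u c - ξ * (x - c)| ≤ E * ((d - c) * (ρ ^ β + K)) := fun ρ hρ hρ1 hQρ hcl x hx =>
    abs_sub_chord_le_of_close hab hB hR hu hint hc hcd hd (by linarith) hud hρ hρ1 hcl hwAC hwc hwd
      (fun x hx => hwfg x (hfg x (hsub hx)).le) (fun x hx => (hwlin x hx).trans hQρ) hK0 hwK hwint hx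
  have h1 := step 1 one_pos le_rfl (by linarith) (fun x hx => by
    have h1 := hδu x (hsub hx) c hcI (by rw [Real.dist_eq]; linarith [hxc x hx])
    rw [Real.dist_eq] at h1
    have h2 := hxc x hx
    have h3 : d - c ≤ Q * (d - c) := le_mul_of_one_le_left hdc.le hQ1
    linarith)
  have h2 := step (Q * (d - c)) (by positivity) (by linarith) le_rfl (fun x hx => by
    have h3 := h1 x hx
    rw [Real.one_rpow] at h3
    have h4 : |u x - u c| ≤ E * ((d - c) * (1 + K)) + |M| * (d - c) := by
      calc |u x - u c| = |(u x - u c - ξ * (x - c)) + ξ * (x - c)| := by ring_nf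
        _ ≤ _ := (abs_add_le _ _).trans (add_le_add h3 (hlin x hx))
    have h5 : E * ((d - c) * (1 + K)) ≤ E * ((d - c) * (1 + K₀)) := by gcongr
    have h6 := hxc x hx
    have h7 : 0 ≤ K₀ * (d - c) := by positivity
    rw [hQ]
    linarith) x hx
  refine h2.trans ?_
  rw [Real.mul_rpow (by linarith) hdc.le]
  have hQβ : 0 < Q ^ β := Real.rpow_pos_of_pos (by linarith) _
  have e1 : 0 ≤ E * ((d - c) * (d - c) ^ β) := by positivity
  have e2 : 0 ≤ E * Q ^ β * ((d - c) * K) := by positivity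
  linarith

end

/-! ### Dyadic sums of moduli -/

/-- The dyadic sums `∑ e(t / 2 ^ j)` are bounded and tend to `0` with `t`: the discrete form of the
Dini condition on `e`. -/
def DyadicallySummable (e : ℝ → ℝ) : Prop :=
  ∀ η > 0, ∃ ε > 0, ∀ t, 0 < t → t ≤ ε → ∀ n : ℕ, ∑ j ∈ Finset.range n, e (t / 2 ^ j) ≤ η

lemma DyadicallySummable.add {e₁ e₂ : ℝ → ℝ} (h₁ : DyadicallySummable e₁)
    (h₂ : DyadicallySummable e₂) : DyadicallySummable fun t => e₁ t + e₂ t := by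
  intro η hη
  obtain ⟨ε₁, hε₁, H₁⟩ := h₁ (η / 2) (half_pos hη)
  obtain ⟨ε₂, hε₂, H₂⟩ := h₂ (η / 2) (half_pos hη)
  refine ⟨min ε₁ ε₂, lt_min hε₁ hε₂, fun t ht htε n => ?_⟩
  rw [Finset.sum_add_distrib]
  linarith [H₁ t ht (htε.trans (min_le_left _ _)) n, H₂ t ht (htε.trans (min_le_right _ _)) n]

lemma DyadicallySummable.const_mul {e : ℝ → ℝ} (h : DyadicallySummable e) {N : ℝ} (hN : 0 < N) :
    DyadicallySummable fun t => N * e t := by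
  intro η hη
  obtain ⟨ε, hε, H⟩ := h (η / N) (div_pos hη hN)
  refine ⟨ε, hε, fun t ht htε n => ?_⟩
  rw [← Finset.mul_sum, ← le_div_iff₀' hN]
  exact H t ht htε n

lemma dyadicallySummable_rpow {β : ℝ} (hβ : 0 < β) : DyadicallySummable fun t => t ^ β := by
  intro η hη
  set r : ℝ := (1 / 2) ^ β with hr
  have hr0 : 0 ≤ r := by positivity
  have hr1 : r < 1 := Real.rpow_lt_one (by norm_num) (by norm_num) hβ
  have h1r : 0 < 1 - r := by linarith
  have hlim : Tendsto (fun t : ℝ => t ^ β) (𝓝[>] 0) (𝓝 0) := by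
    have := (Real.continuousAt_rpow_const 0 β (Or.inr hβ.le)).tendsto
    rw [Real.zero_rpow hβ.ne'] at this
    exact this.mono_left nhdsWithin_le_nhds
  have hev := hlim.eventually_lt_const (mul_pos hη h1r)
  obtain ⟨ε, hε, hε'⟩ := mem_nhdsGT_iff_exists_Ioc_subset.1 hev
  refine ⟨ε, hε, fun t ht htε n => ?_⟩
  have e : ∀ j : ℕ, (t / 2 ^ j) ^ β = t ^ β * r ^ j := fun j => by
    rw [div_eq_mul_one_div, ← one_div_pow, Real.mul_rpow ht.le (by positivity), hr,
      Real.rpow_pow_comm (by norm_num)]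
  simp only [e]
  rw [← Finset.mul_sum]
  have hsum : ∑ j ∈ Finset.range n, r ^ j ≤ (1 - r)⁻¹ := by
    rw [← tsum_geometric_of_lt_one hr0 hr1]
    exact (summable_geometric_of_lt_one hr0 hr1).sum_le_tsum _ fun j _ => by positivity
  calc t ^ β * ∑ j ∈ Finset.range n, r ^ j ≤ η * (1 - r) * (1 - r)⁻¹ :=
        mul_le_mul (le_of_lt (hε' ⟨ht, htε⟩)) hsum (Finset.sum_nonneg fun j _ => by positivity)
          (by positivity)
    _ = η := by field_simp

lemma sum_ofReal_dyadic_le_lintegral {ω : ℝ → ℝ} (hω : Monotone ω) (hω0 : ∀ t, 0 ≤ ω t) (n : ℕ) :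
    ∀ t > 0, ∑ j ∈ Finset.range n, ENNReal.ofReal (ω (t / 2 ^ j)) ≤
      2 * ∫⁻ ξ in Ioo 0 (2 * t), ENNReal.ofReal (ω ξ / ξ) := by
  induction n with
  | zero => intro t _; simp
  | succ n ih =>
    intro t ht
    have h1 := ih (t / 2) (half_pos ht)
    have h2 : ENNReal.ofReal (ω t) ≤ 2 * ∫⁻ ξ in Ioo t (2 * t), ENNReal.ofReal (ω ξ / ξ) := by
      calc ENNReal.ofReal (ω t)
          = 2 * ∫⁻ _ in Ioo t (2 * t), ENNReal.ofReal (ω t / (2 * t)) := by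
            rw [setLIntegral_const, Real.volume_Ioo, ← ENNReal.ofReal_mul
              (div_nonneg (hω0 t) (by positivity)), ← ENNReal.ofReal_ofNat 2,
              ← ENNReal.ofReal_mul (by norm_num)]
            congr 1
            field_simp
            ring
        _ ≤ _ := by
            gcongr 2 * ?_
            refine setLIntegral_mono' measurableSet_Ioo fun ξ hξ => ENNReal.ofReal_le_ofReal ?_
            have hξ0 : 0 < ξ := ht.trans hξ.1
            exact div_le_div₀ (hω0 ξ) (hω hξ.1.le) hξ0 hξ.2.le
    have h3 : (∫⁻ ξ in Ioo 0 (2 * (t / 2)), ENNReal.ofReal (ω ξ / ξ)) +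
        (∫⁻ ξ in Ioo t (2 * t), ENNReal.ofReal (ω ξ / ξ)) ≤
          ∫⁻ ξ in Ioo 0 (2 * t), ENNReal.ofReal (ω ξ / ξ) := by
      rw [mul_div_cancel₀ t two_ne_zero, ← lintegral_union measurableSet_Ioo
        (disjoint_left.2 fun x hx hx' => absurd hx.2 (not_lt.2 hx'.1.le))]
      refine lintegral_mono_set (union_subset (Ioo_subset_Ioo_right (by linarith))
        (Ioo_subset_Ioo_left ht.le))
    rw [Finset.sum_range_succ', pow_zero, div_one]
    calc _ ≤ 2 * (∫⁻ ξ in Ioo 0 (2 * (t / 2)), ENNReal.ofReal (ω ξ / ξ)) +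
          2 * ∫⁻ ξ in Ioo t (2 * t), ENNReal.ofReal (ω ξ / ξ) := by
          refine add_le_add (le_trans (le_of_eq ?_) h1) h2
          refine Finset.sum_congr rfl fun j _ => ?_
          rw [pow_succ, div_div, mul_comm]
      _ ≤ _ := by
          rw [← mul_add]
          gcongr

/-- The integral condition with `γ = θ = 1` already gives summability of the modulus itself over
dyadic scales, since the modulus is monotone. -/
lemma dyadicallySummable_modulus {a b : ℝ} {h : ℝ → ℝ} (hh : ContinuousOn h (Icc a b))
    (hmod : Tendsto (fun ε : ℝ => ∫⁻ ξ in Ioo (0 : ℝ) (Real.exp 1 * ε),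
      ENNReal.ofReal (modulus a b h (ξ + 1 * Real.sqrt ξ) ^ (1 : ℝ) / ξ)) (𝓝[>] 0) (𝓝 0)) :
    DyadicallySummable (modulus a b h) := by
  intro η hη
  have hη' : (0 : ENNReal) < ENNReal.ofReal (η / 2) := by simpa using hη
  obtain ⟨ε, hε, hε'⟩ := mem_nhdsGT_iff_exists_Ioc_subset.1 (hmod.eventually_lt_const hη')
  refine ⟨ε, hε, fun t ht htε n => ?_⟩
  have h1 : (∫⁻ ξ in Ioo 0 (2 * t), ENNReal.ofReal (modulus a b h ξ / ξ)) ≤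
      ENNReal.ofReal (η / 2) := by
    refine le_trans ?_ (le_of_lt (hε' ⟨ht, htε⟩))
    refine (lintegral_mono_set (Ioo_subset_Ioo_right
      (mul_le_mul_of_nonneg_right Real.exp_one_gt_two.le ht.le))).trans ?_
    refine setLIntegral_mono' measurableSet_Ioo fun ξ hξ => ENNReal.ofReal_le_ofReal ?_
    rw [Real.rpow_one]
    exact div_le_div_of_nonneg_right
      (modulus_mono hh (by linarith [Real.sqrt_nonneg ξ])) hξ.1.le
  have h2 := (sum_ofReal_dyadic_le_lintegral (modulus_mono hh) (modulus_nonneg a b h) n t ht).trans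
    (mul_le_mul_right h1 2)
  rw [← ENNReal.ofReal_sum_of_nonneg fun j _ => modulus_nonneg .., ← ENNReal.ofReal_ofNat 2,
    ← ENNReal.ofReal_mul (by norm_num), ENNReal.ofReal_le_ofReal_iff (by positivity)] at h2
  linarith

/-! ### Stability of slopes under passing to subintervals -/

/-- If the slope changes by at most `e(t)` when an interval of length `t` is replaced by a subinterval
of at least half its length, then `n` such steps reach every subinterval whose length is at least the
fraction `2⁻ⁿ` of the whole; the bound `M` on the slopes has to survive all of them. -/
lemma abs_slope_sub_slope_le_sum {a b ε M : ℝ} {u e : ℝ → ℝ} (he : ∀ t, 0 < t → 0 ≤ e t)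
    (H : ∀ c d c' d' : ℝ, a ≤ c → d ≤ b → d - c ≤ ε → c ≤ c' → c' < d' → d' ≤ d →
      d - c ≤ 2 * (d' - c') → |slope u c d| ≤ M → |slope u c' d' - slope u c d| ≤ e (d - c))
    (n : ℕ) : ∀ c d c' d' : ℝ, a ≤ c → d ≤ b → d - c ≤ ε → c ≤ c' → c' < d' → d' ≤ d →
      d - c ≤ 2 ^ n * (d' - c') → |slope u c d| + ∑ j ∈ Finset.range n, e ((d - c) / 2 ^ j) ≤ M →
      |slope u c' d' - slope u c d| ≤ ∑ j ∈ Finset.range n, e ((d - c) / 2 ^ j) := by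
  induction n with
  | zero =>
    intro c d c' d' _ _ _ hc hcd hd h _
    have h1 : c' = c := by linarith
    have h2 : d' = d := by linarith
    simp [h1, h2]
  | succ n ih =>
    intro c d c' d' hac hdb hε hc hcd hd h hM
    have hdc : 0 < d - c := by linarith
    have hsum : ∀ m, 0 ≤ ∑ j ∈ Finset.range m, e ((d - c) / 2 ^ (j + 1)) := fun m =>
      Finset.sum_nonneg fun j _ => he _ (by positivity)
    rw [Finset.sum_range_succ', pow_zero, div_one] at hM ⊢
    rcases le_or_gt (d - c) (2 * (d' - c')) with h2 | h2
    · have := H c d c' d' hac hdb hε hc hcd hd h2 (by linarith [hsum n, he _ hdc])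
      linarith [hsum n]
    -- An interval of half the length between `[c',d']` and `[c,d]`.
    set c₁ := max c (d' - (d - c) / 2) with hc₁
    set d₁ := c₁ + (d - c) / 2 with hd₁
    have e1 : d₁ - c₁ = (d - c) / 2 := by rw [hd₁]; ring
    have b1 : c ≤ c₁ := le_max_left _ _
    have b2 : d' - (d - c) / 2 ≤ c₁ := le_max_right _ _
    have b3 : c₁ ≤ c' := max_le hc (by linarith)
    have b4 : d₁ ≤ d := by
      have : c₁ ≤ d - (d - c) / 2 := max_le (by linarith) (by linarith)
      linarith
    have h3 := H c d c₁ d₁ hac hdb hε b1 (by linarith) b4 (by linarith)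
      (by linarith [hsum n, he _ hdc])
    have e2 : ∑ j ∈ Finset.range n, e ((d₁ - c₁) / 2 ^ j) =
        ∑ j ∈ Finset.range n, e ((d - c) / 2 ^ (j + 1)) := by
      refine Finset.sum_congr rfl fun j _ => ?_
      rw [e1, pow_succ', div_div]
    have h4 : |slope u c₁ d₁| ≤ |slope u c d| + e (d - c) := by
      calc |slope u c₁ d₁| = |slope u c d + (slope u c₁ d₁ - slope u c d)| := by ring_nf
        _ ≤ _ := (abs_add_le _ _).trans (add_le_add_right h3 _)
    have h5 := ih c₁ d₁ c' d' (hac.trans b1) (b4.trans hdb) (by linarith) b3 hcd (by linarith)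
      (by rw [e1]; rw [pow_succ] at h; linarith) (by rw [e2]; linarith)
    rw [e2] at h5
    calc |slope u c' d' - slope u c d|
        = |(slope u c' d' - slope u c₁ d₁) + (slope u c₁ d₁ - slope u c d)| := by ring_nf
      _ ≤ _ := (abs_add_le _ _).trans (add_le_add h5 h3)

/-- Short intervals of bounded slope have almost constant slope: every subinterval has nearly
the same slope. -/
def SlopeStable (a b : ℝ) (u : ℝ → ℝ) : Prop :=
  ∀ M : ℝ, ∀ δ > 0, ∃ ε > 0, ∀ c d c' d' : ℝ, a ≤ c → d ≤ b → d - c ≤ ε → c ≤ c' → c' < d' →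
    d' ≤ d → |slope u c d| ≤ M → |slope u c' d' - slope u c d| ≤ δ

lemma slopeStable_of_mem_solutions {a b A B : ℝ} {L : ℝ → ℝ → ℝ → ℝ} {f g u : ℝ → ℝ} (hab : a < b)
    (hL : LagContinuous a b L) (hH1 : LocallyHolder a b L) (hH2 : GloballyElliptic a b L)
    (hf : ContDiffOn ℝ 1 f (Icc a b)) (hg : ContDiffOn ℝ 1 g (Icc a b))
    (hfg : ∀ x ∈ Icc a b, f x < g x)
    (hmf : DyadicallySummable (modulus a b (derivWithin f (Icc a b))))
    (hmg : DyadicallySummable (modulus a b (derivWithin g (Icc a b))))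
    (hu : u ∈ solutions a b A B L f g) : SlopeStable a b u := by
  intro M δ hδ
  obtain ⟨N, hN, β, hβ, ε₁, hε₁, hchord⟩ :=
    exists_abs_sub_chord_le hab hL hH1 hH2 hf hg hfg hu (M + δ)
  set e : ℝ → ℝ := fun t => 4 * N * (t ^ β + obstacleModulus a b f g t) with he
  have hsum : DyadicallySummable e :=
    ((dyadicallySummable_rpow hβ).add (hmf.add hmg)).const_mul (by positivity)
  obtain ⟨ε₂, hε₂, hsum⟩ := hsum δ hδ
  have he0 : ∀ t, 0 < t → 0 ≤ e t := fun t ht => by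
    have := obstacleModulus_nonneg a b f g t
    positivity
  have hstep : ∀ c d c' d' : ℝ, a ≤ c → d ≤ b → d - c ≤ min ε₁ ε₂ → c ≤ c' → c' < d' → d' ≤ d →
      d - c ≤ 2 * (d' - c') → |slope u c d| ≤ M + δ →
        |slope u c' d' - slope u c d| ≤ e (d - c) := by
    intro c d c' d' hac hdb hε hc hcd hd h hM
    have hdc : 0 < d - c := by linarith
    have hdc' : 0 < d' - c' := by linarith
    have hs : u d = u c + slope u c d * (d - c) := by
      rw [slope_def_field, div_mul_cancel₀ _ hdc.ne']; ring
    have hs' : u d' = u c' + slope u c' d' * (d' - c') := by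
      rw [slope_def_field, div_mul_cancel₀ _ hdc'.ne']; ring
    have H := hchord c d (slope u c d) hac (by linarith) hdb (hε.trans (min_le_left _ _)) hM hs
    have h1 := abs_le.1 (H c' ⟨hc, by linarith⟩)
    have h2 := abs_le.1 (H d' ⟨by linarith, hd⟩)
    set m := (d - c) ^ β + obstacleModulus a b f g (d - c)
    have hm : 0 ≤ N * m := by
      have := obstacleModulus_nonneg a b f g (d - c)
      have : 0 ≤ m := by positivity
      positivity
    have h3 := mul_le_mul_of_nonneg_left h hm
    have key : |(slope u c' d' - slope u c d) * (d' - c')| ≤ e (d - c) * (d' - c') := by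
      have : e (d - c) = 4 * N * m := rfl
      rw [this, abs_le]
      constructor <;> nlinarith
    rw [abs_mul, abs_of_pos hdc'] at key
    exact le_of_mul_le_mul_right key hdc'
  refine ⟨min ε₁ ε₂, lt_min hε₁ hε₂, fun c d c' d' hac hdb hε hc hcd hd hM => ?_⟩
  obtain ⟨n, hn⟩ := pow_unbounded_of_one_lt ((d - c) / (d' - c')) one_lt_two
  have hbd := hsum (d - c) (by linarith) (hε.trans (min_le_right _ _)) n
  exact (abs_slope_sub_slope_le_sum he0 hstep n c d c' d' hac hdb hε hc hcd hd
    ((div_lt_iff₀ (by linarith)).1 hn).le (by linarith)).trans hbd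

section

/-! ### From stability of slopes to partial regularity -/

variable {a b : ℝ} {u : ℝ → ℝ}

/-- The nondegenerate subintervals `[c,d]` of `[a,b]`, as pairs of end points. -/
def subintervals (a b : ℝ) : Set (ℝ × ℝ) := {p | a ≤ p.1 ∧ p.1 < p.2 ∧ p.2 ≤ b}

lemma convex_subintervals (a b : ℝ) : Convex ℝ (subintervals a b) := by
  rintro ⟨c, d⟩ ⟨h1, h2, h3⟩ ⟨c', d'⟩ ⟨h1', h2', h3'⟩ s t hs ht hst
  simp only [subintervals, mem_ofPred_eq, Prod.smul_mk, Prod.mk_add_mk, smul_eq_mul] at *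
  have e : s = 1 - t := by linarith
  refine ⟨by subst e; nlinarith, ?_, by subst e; nlinarith⟩
  rcases hs.eq_or_lt with rfl | hs
  · have : t = 1 := by linarith
    subst this; linarith
  · nlinarith

lemma continuousOn_slope_subintervals (hu : ContinuousOn u (Icc a b)) :
    ContinuousOn (fun p : ℝ × ℝ => slope u p.1 p.2) (subintervals a b) := by
  simp only [slope_def_field]
  refine ContinuousOn.div ?_ (by fun_prop) fun p hp => by linarith [hp.2.1]
  exact (hu.comp continuousOn_snd fun p hp => ⟨hp.1.trans hp.2.1.le, hp.2.2⟩).sub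
    (hu.comp continuousOn_fst fun p hp => ⟨hp.1, hp.2.1.le.trans hp.2.2⟩)

lemma mem_closure_subintervals (hab : a < b) {x : ℝ} (hx : x ∈ Icc a b) :
    (x, x) ∈ closure (subintervals a b) := by
  rw [Metric.mem_closure_iff]
  intro ε hε
  rcases hx.2.lt_or_eq with h | rfl
  · have h1 : x < min b (x + ε / 2) := lt_min h (by linarith)
    refine ⟨(x, min b (x + ε / 2)), ⟨hx.1, h1, min_le_left _ _⟩, ?_⟩
    have := min_le_right b (x + ε / 2)
    rw [Prod.dist_eq, max_lt_iff, dist_self, Real.dist_eq, abs_sub_lt_iff]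
    exact ⟨hε, by linarith, by linarith⟩
  · have h1 : max a (x - ε / 2) < x := max_lt hab (by linarith)
    refine ⟨(max a (x - ε / 2), x), ⟨le_max_left _ _, h1, le_rfl⟩, ?_⟩
    have := le_max_right a (x - ε / 2)
    rw [Prod.dist_eq, max_lt_iff, dist_self, Real.dist_eq, abs_sub_lt_iff]
    exact ⟨⟨by linarith, by linarith⟩, hε⟩

/-- Stability allows an interval of bounded slope to be enlarged: while it grows, its slope cannot
leave the bounded range, because it stays close to the slope of the initial interval. -/
lemma abs_slope_le_of_subinterval (hu : ContinuousOn u (Icc a b)) {M ε : ℝ}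
    (H : ∀ c d c' d' : ℝ, a ≤ c → d ≤ b → d - c ≤ ε → c ≤ c' → c' < d' →
      d' ≤ d → |slope u c d| ≤ M + 2 → |slope u c' d' - slope u c d| ≤ 1)
    {p q c d : ℝ} (hp : a ≤ p) (hq : q ≤ b) (hpq : q - p ≤ ε) (hc : p ≤ c) (hcd : c < d)
    (hd : d ≤ q) (hM : |slope u c d| ≤ M) : |slope u p q| ≤ M + 2 := by
  by_contra! hlt
  have hmem : ∀ s ∈ Icc (0 : ℝ) 1, p ≤ c + s * (p - c) ∧ c + s * (p - c) ≤ c ∧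
      d ≤ d + s * (q - d) ∧ d + s * (q - d) ≤ q := by
    intro s hs
    have h1 := mul_nonneg hs.1 (by linarith : 0 ≤ c - p)
    have h2 := mul_nonneg hs.1 (by linarith : 0 ≤ q - d)
    have h3 := mul_le_mul_of_nonneg_right hs.2 (by linarith : 0 ≤ c - p)
    have h4 := mul_le_mul_of_nonneg_right hs.2 (by linarith : 0 ≤ q - d)
    refine ⟨?_, ?_, ?_, ?_⟩ <;> linarith
  have hcont : ContinuousOn (fun s : ℝ => |slope u (c + s * (p - c)) (d + s * (q - d))|)
      (Icc 0 1) := by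
    refine ((continuousOn_slope_subintervals hu).comp
      (f := fun s : ℝ => (c + s * (p - c), d + s * (q - d))) (by fun_prop) ?_).abs
    intro s hs
    obtain ⟨h1, h2, h3, h4⟩ := hmem s hs
    exact ⟨by linarith, by simp only; linarith, by linarith⟩
  obtain ⟨s, hs, hsM⟩ := intermediate_value_Icc zero_le_one hcont
    (show M + 2 ∈ Icc _ _ by
      constructor
      · simp only [zero_mul, add_zero]; linarith
      · simp only [one_mul, add_sub_cancel]; exact hlt.le)
  obtain ⟨h1, h2, h3, h4⟩ := hmem s hs
  simp only at hsM
  have h5 := H _ _ c d (by linarith) (by linarith) (by linarith) h2 hcd h3 hsM.le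
  have h6 := abs_sub_abs_le_abs_sub (slope u (c + s * (p - c)) (d + s * (q - d))) (slope u c d)
  rw [abs_sub_comm] at h6
  linarith

/-- The slopes of the intervals shrinking to a point have a limit in `[-∞,∞]`. -/
lemma exists_tendsto_slope_nhds (hab : a < b) (hu : ContinuousOn u (Icc a b))
    (hs : SlopeStable a b u) {x : ℝ} (hx : x ∈ Icc a b) :
    ∃ D : EReal, Tendsto (fun p : ℝ × ℝ => ((slope u p.1 p.2 : ℝ) : EReal))
      (𝓝[subintervals a b] (x, x)) (𝓝 D) := by
  set F := 𝓝[subintervals a b] (x, x) with hF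
  have : NeBot F := mem_closure_iff_nhdsWithin_neBot.1 (mem_closure_subintervals hab hx)
  have hnear : ∀ r > 0, ∀ᶠ p in F, p ∈ subintervals a b ∧ |p.1 - x| < r ∧ |p.2 - x| < r := by
    intro r hr
    filter_upwards [self_mem_nhdsWithin, mem_nhdsWithin_of_mem_nhds (Metric.ball_mem_nhds _ hr)]
      with p hp hpr
    rw [Metric.mem_ball, Prod.dist_eq, max_lt_iff, Real.dist_eq, Real.dist_eq] at hpr
    exact ⟨hp, hpr⟩
  by_cases hinf : ∀ M : ℝ, ∀ᶠ p in F, M < |slope u p.1 p.2|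
  · -- All slopes are large near `x`; by connectedness they have the same sign.
    obtain ⟨r, hr, hpos⟩ := (Metric.nhdsWithin_basis_ball.eventually_iff).1 (hinf 0)
    set S := Metric.ball (x, x) r ∩ subintervals a b with hS
    have hSF : ∀ᶠ p in F, p ∈ S := by
      filter_upwards [self_mem_nhdsWithin, mem_nhdsWithin_of_mem_nhds (Metric.ball_mem_nhds _ hr)]
        with p hp hpr using ⟨hpr, hp⟩
    have hconn : IsPreconnected S :=
      ((convex_ball (x, x) r).inter (convex_subintervals a b)).isPreconnected
    have hcont := (continuousOn_slope_subintervals hu).mono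
      (inter_subset_right : S ⊆ subintervals a b)
    have hsign : (∀ p ∈ S, 0 < slope u p.1 p.2) ∨ ∀ p ∈ S, slope u p.1 p.2 < 0 := by
      by_contra! hcon
      obtain ⟨⟨p, hp, hp'⟩, q, hq, hq'⟩ := hcon
      obtain ⟨z, hz, hz'⟩ := hconn.intermediate_value hp hq hcont ⟨hp', hq'⟩
      have := hpos hz
      simp only at hz'
      simp [hz'] at this
    rcases hsign with hsign | hsign
    · refine ⟨⊤, EReal.tendsto_coe_nhds_top_iff.2 (tendsto_atTop.2 fun M => ?_)⟩
      filter_upwards [hinf M, hSF] with p hp hpS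
      rw [abs_of_pos (hsign p hpS)] at hp
      exact hp.le
    · refine ⟨⊥, EReal.tendsto_coe_nhds_bot_iff.2 (tendsto_atBot.2 fun M => ?_)⟩
      filter_upwards [hinf (-M), hSF] with p hp hpS
      rw [abs_of_neg (hsign p hpS)] at hp
      linarith
  · obtain ⟨M, hM⟩ := not_forall.1 hinf
    have hM : ∃ᶠ p in F, |slope u p.1 p.2| ≤ M := (not_eventually.1 hM).mono fun _ => not_lt.1
    -- Near `x` there are intervals of slope at most `M`; enlarged to a neighbourhood of `x`, they
    -- bring all slopes near `x` within `η / 3` of a single one.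
    have hcauchy : Cauchy (map (fun p : ℝ × ℝ => slope u p.1 p.2) F) := by
      rw [Metric.cauchy_iff]
      refine ⟨inferInstance, fun η hη => ?_⟩
      have hδ : 0 < min 1 (η / 3) := lt_min one_pos (by positivity)
      obtain ⟨ε, hε, H⟩ := hs (M + 2) _ hδ
      set p := max a (x - ε / 2) with hp
      set q := min b (x + ε / 2) with hq
      have hpx : x - ε / 2 ≤ p := le_max_right _ _
      have hqx : q ≤ x + ε / 2 := min_le_right _ _
      have hsub : ∀ z ∈ subintervals a b, |z.1 - x| < ε / 2 → |z.2 - x| < ε / 2 →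
          p ≤ z.1 ∧ z.1 < z.2 ∧ z.2 ≤ q := fun z hz h1 h2 =>
        ⟨max_le hz.1 (by linarith [(abs_lt.1 h1).1]), hz.2.1,
          le_min hz.2.2 (by linarith [(abs_lt.1 h2).2])⟩
      obtain ⟨z, hzM, hz, hz1, hz2⟩ := (hM.and_eventually (hnear (ε / 2) (by positivity))).exists
      obtain ⟨k1, k2, k3⟩ := hsub z hz hz1 hz2
      have hpq : |slope u p q| ≤ M + 2 := abs_slope_le_of_subinterval hu
        (fun c d c' d' h1 h2 h3 h4 h5 h6 h7 =>
          (H c d c' d' h1 h2 h3 h4 h5 h6 h7).trans (min_le_left _ _))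
        (le_max_left _ _) (min_le_left _ _) (by linarith) k1 k2 k3 hzM
      refine ⟨Metric.closedBall (slope u p q) (η / 3), ?_, fun y hy y' hy' => ?_⟩
      · rw [mem_map]
        filter_upwards [hnear (ε / 2) (by positivity)] with z ⟨hz, hz1, hz2⟩
        obtain ⟨k1, k2, k3⟩ := hsub z hz hz1 hz2
        exact (H p q z.1 z.2 (le_max_left _ _) (min_le_left _ _) (by linarith) k1 k2 k3 hpq).trans
          (min_le_right _ _)
      · have := dist_triangle_right y y' (slope u p q)
        rw [Metric.mem_closedBall] at hy hy'
        linarith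
    obtain ⟨D, hD⟩ := cauchy_map_iff_exists_tendsto.1 hcauchy
    exact ⟨D, EReal.tendsto_coe.2 hD⟩

lemma hasExtDerivAt_of_tendsto_slope {x : ℝ} {D : EReal} (hx : x ∈ Icc a b)
    (h : Tendsto (fun p : ℝ × ℝ => ((slope u p.1 p.2 : ℝ) : EReal))
      (𝓝[subintervals a b] (x, x)) (𝓝 D)) : HasExtDerivAt a b u D x := by
  unfold HasExtDerivAt
  have hset : Icc a b \ {x} = (Icc a b ∩ Ioi x) ∪ (Icc a b ∩ Iio x) := by
    ext y
    constructor
    · rintro ⟨hy, hne⟩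
      exact (lt_or_gt_of_ne hne).elim (fun h => Or.inr ⟨hy, h⟩) fun h => Or.inl ⟨hy, h⟩
    · rintro (⟨hy, h⟩ | ⟨hy, h⟩)
      · exact ⟨hy, ne_of_gt h⟩
      · exact ⟨hy, ne_of_lt h⟩
  rw [hset, nhdsWithin_union, tendsto_sup]
  constructor
  · have h1 : Tendsto (fun y : ℝ => (x, y)) (𝓝[Icc a b ∩ Ioi x] x)
        (𝓝[subintervals a b] (x, x)) := by
      refine tendsto_nhdsWithin_iff.2 ⟨?_, ?_⟩
      · exact ((Continuous.prodMk_right x).tendsto x).mono_left nhdsWithin_le_nhds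
      · filter_upwards [self_mem_nhdsWithin] with y hy using ⟨hx.1, hy.2, hy.1.2⟩
    refine (h.comp h1).congr fun y => ?_
    simp [slope_def_field]
  · have h1 : Tendsto (fun y : ℝ => (y, x)) (𝓝[Icc a b ∩ Iio x] x)
        (𝓝[subintervals a b] (x, x)) := by
      refine tendsto_nhdsWithin_iff.2 ⟨?_, ?_⟩
      · exact ((Continuous.prodMk_left x).tendsto x).mono_left nhdsWithin_le_nhds
      · filter_upwards [self_mem_nhdsWithin] with y hy using ⟨hy.1.1, hy.2, hx.2⟩
    refine (h.comp h1).congr fun y => ?_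
    simp only [Function.comp_apply]
    rw [slope_comm, slope_def_field]

lemma mem_diffSet_iff {x : ℝ} (hx : x ∈ Icc a b) :
    x ∈ diffSet a b u ↔ ∃ d : ℝ, HasExtDerivAt a b u d x := by
  have key : ∀ d : ℝ, HasDerivWithinAt u d (Icc a b) x ↔ HasExtDerivAt a b u d x := by
    intro d
    rw [hasDerivWithinAt_iff_tendsto_slope, HasExtDerivAt, EReal.tendsto_coe]
    refine tendsto_congr fun y => ?_
    rw [slope_def_field]
  constructor
  · rintro ⟨-, h⟩
    exact ⟨_, (key _).1 h.hasDerivWithinAt⟩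
  · rintro ⟨d, h⟩
    exact ⟨hx, ((key d).2 h).differentiableWithinAt⟩

lemma HasExtDerivAt.unique (hab : a < b) {x : ℝ} (hx : x ∈ Icc a b) {D D' : EReal}
    (h : HasExtDerivAt a b u D x) (h' : HasExtDerivAt a b u D' x) : D = D' := by
  have : NeBot (𝓝[Icc a b \ {x}] x) :=
    accPt_principal_iff_nhdsWithin.1 ((uniqueDiffOn_Icc hab x hx).accPt)
  exact tendsto_nhds_unique h h'

/-- Stability of slopes gives Tonelli's partial regularity: the extended derivative is a limit of
slopes of intervals shrinking to a point from any position, and such limits are continuous. -/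
lemma tonelliPartialRegularity_of_slopeStable (hab : a < b) (hAC : MemW11 a b u)
    (hs : SlopeStable a b u) : TonelliPartialRegularity a b u := by
  have hu : ContinuousOn u (Icc a b) := by
    simpa [uIcc_of_le hab.le] using AbsolutelyContinuousOnInterval.continuousOn hAC
  set S : ℝ × ℝ → EReal := fun p => ((slope u p.1 p.2 : ℝ) : EReal) with hS
  set u' : ℝ → EReal := fun x => extendFrom (subintervals a b) S (x, x) with hu'
  have hlim : ∀ x ∈ Icc a b, ∃ D, Tendsto S (𝓝[subintervals a b] (x, x)) (𝓝 D) :=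
    fun x hx => exists_tendsto_slope_nhds hab hu hs hx
  have hder : ∀ x ∈ Icc a b, HasExtDerivAt a b u (u' x) x := fun x hx =>
    hasExtDerivAt_of_tendsto_slope hx (tendsto_extendFrom (hlim x hx))
  have hcont : ContinuousOn u' (Icc a b) := by
    have := continuousOn_extendFrom (f := S) (A := subintervals a b)
      (B := (fun x : ℝ => (x, x)) '' Icc a b)
      (by rintro _ ⟨x, hx, rfl⟩; exact mem_closure_subintervals hab hx)
      (by rintro _ ⟨x, hx, rfl⟩; exact hlim x hx)
    exact this.comp (f := fun x : ℝ => (x, x)) (by fun_prop) fun x hx => ⟨x, hx, rfl⟩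
  have hdiff : ∀ x ∈ Icc a b, (x ∈ diffSet a b u ↔ u' x ∈ ({⊥, ⊤} : Set EReal)ᶜ) := by
    intro x hx
    rw [mem_diffSet_iff hx]
    constructor
    · rintro ⟨d, hd⟩
      rw [(hder x hx).unique hab hx hd]
      simp
    · intro h
      simp only [mem_compl_iff, mem_insert_iff, mem_singleton_iff, not_or] at h
      refine ⟨(u' x).toReal, ?_⟩
      rw [EReal.coe_toReal h.2 h.1]
      exact hder x hx
  refine ⟨hAC, ?_, ?_, u', hder, hcont⟩
  · have hopen : IsOpen ({⊥, ⊤} : Set EReal)ᶜ := (toFinite _).isClosed.isOpen_compl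
    obtain ⟨U, hU, hU'⟩ := continuousOn_iff'.1 hcont _ hopen
    refine ⟨U, hU, ?_⟩
    rw [inter_comm, ← hU']
    ext x
    exact ⟨fun h => ⟨(hdiff x h.1).1 h, h.1⟩, fun h => (hdiff x h.2).2 h.1⟩
  · ext x
    rw [Set.mem_sdiff, mem_ofPred_eq]
    refine and_congr_right fun hx => ?_
    rw [hdiff x hx, notMem_compl_iff, mem_insert_iff, mem_singleton_iff]
    constructor
    · rintro (h | h)
      · exact Or.inl (h ▸ hder x hx)
      · exact Or.inr (h ▸ hder x hx)
    · rintro (h | h)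
      · exact Or.inl ((hder x hx).unique hab hx h)
      · exact Or.inr ((hder x hx).unique hab hx h)

end

end ObstacleProblem

theorem mainTheorem3 (a b A B : ℝ) (hab : a < b)
    (L : ℝ → ℝ → ℝ → ℝ)
    (hL : ObstacleProblem.LagContinuous a b L)
    (hH1 : ObstacleProblem.LocallyHolder a b L)
    (hH2 : ObstacleProblem.GloballyElliptic a b L)
    (f g : ℝ → ℝ)
    (hf : ContDiffOn ℝ 1 f (Icc a b)) (hg : ContDiffOn ℝ 1 g (Icc a b))
    (hfg : ∀ x ∈ Icc a b, f x < g x)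
    (hmod : ∀ h ∈ ({f, derivWithin f (Icc a b), g, derivWithin g (Icc a b)} : Set (ℝ → ℝ)),
      ∀ γ > (0 : ℝ), ∀ θ > (0 : ℝ),
        Tendsto
          (fun ε : ℝ => ∫⁻ ξ in Ioo (0 : ℝ) (Real.exp 1 * ε),
            ENNReal.ofReal (ObstacleProblem.modulus a b h (ξ + γ * Real.sqrt ξ) ^ θ / ξ))
          (𝓝[>] 0) (𝓝 0)) :
    ∀ u ∈ ObstacleProblem.solutions a b A B L f g,
      ObstacleProblem.TonelliPartialRegularity a b u := by
  intro u hu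
  have hmod' : ∀ h : ℝ → ℝ, ContDiffOn ℝ 1 h (Icc a b) →
      derivWithin h (Icc a b) ∈
        ({f, derivWithin f (Icc a b), g, derivWithin g (Icc a b)} : Set (ℝ → ℝ)) →
      ObstacleProblem.DyadicallySummable
        (ObstacleProblem.modulus a b (derivWithin h (Icc a b))) := fun h hh hmem =>
    ObstacleProblem.dyadicallySummable_modulus
      (hh.continuousOn_derivWithin (uniqueDiffOn_Icc hab) le_rfl)
      (hmod _ hmem 1 one_pos 1 one_pos)
  exact ObstacleProblem.tonelliPartialRegularity_of_slopeStable hab hu.1.1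
    (ObstacleProblem.slopeStable_of_mem_solutions hab hL hH1 hH2 hf hg hfg
      (hmod' f hf (by simp)) (hmod' g hg (by simp)) hu)
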